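/- For real order $\nu\ge 0$ let $J_\nu$ and $Y_\nu$ denote the Bessel functions of the first and second kinds on $(0,\infty)$. Fix $b>1$ and put $$U_\nu(\rho,t)=J_\nu(\rho t)\,Y_\nu(\rho b)-J_\nu(\rho b)\,Y_\nu(\rho t)\qquad(\rho>0,\ t>0),$$ $$\psi_\nu(t)=t^{\nu}-t^{-\nu}\qquad(\nu>0,\ t>0).$$ For every $\nu\ge 0$ the positive zeros of $\rho\mapsto U_\nu(\rho,1)$ form an infinite sequence $\rho_{\nu,1}<\rho_{\nu,2}<\cdots$ (in which every positive zero occurs), and the following holds for every $s$ with $1<s<b$. (a) If $\nu>0$, then $$2\nu\sum_{m=1}^{\infty}\frac{U_\nu(\rho_{\nu,m},s)\,U_\nu(\rho_{\nu,m},t)}{\rho_{\nu,m}^{2}\int_1^b\{U_\nu(\rho_{\nu,m},\tau)\}^2\,\tau\,d\tau}=\begin{cases}\dfrac{\psi_\nu(t)\,\psi_\nu(b/s)}{\psi_\nu(b)}&(1\le t\le s),\\[2ex]\dfrac{\psi_\nu(s)\,\psi_\nu(b/t)}{\psi_\nu(b)}&(s<t\le b),\end{cases}$$ and the series converges uniformly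 for $t\in[1,b]$. (b) In the case $\nu=0$, $$\sum_{m=1}^{\infty}\frac{U_0(\rho_{0,m},s)\,U_0(\rho_{0,m},t)}{\rho_{0,m}^{2}\int_1^b\{U_0(\rho_{0,m},\tau)\}^2\,\tau\,d\tau}=\begin{cases}\dfrac{(\log t)\,\log(b/s)}{\log b}&(1\le t\le s),\\[2ex]\dfrac{(\log s)\,\log(b/t)}{\log b}&(s<t\le b),\end{cases}$$ and the series converges uniformly for $t\in[1,b]$. -/

import Mathlib

/-- The Bessel function of the first kind `J_ν(x)` of real order `ν`, for `x > 0`, by its power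
series. At the poles of `Γ`, `Real.Gamma` is `0`, so the corresponding terms vanish, as in the usual
convention `1 / Γ(-n) = 0`. -/
noncomputable def besselJ (ν x : ℝ) : ℝ :=
  ∑' k : ℕ, (-1 : ℝ) ^ k / ((k.factorial : ℝ) * Real.Gamma (ν + k + 1)) * (x / 2) ^ (2 * (k : ℝ) + ν)

/-- The quotient `(J_ν(x) cos νπ - J_{-ν}(x)) / sin νπ`, meaningful for `ν` not an integer. -/
noncomputable def besselYQuotient (ν x : ℝ) : ℝ :=
  (besselJ ν x * Real.cos (ν * Real.pi) - besselJ (-ν) x) / Real.sin (ν * Real.pi)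

open Classical in
/-- The Bessel function of the second kind `Y_ν(x)` of real order `ν`, for `x > 0`: the quotient
above if `ν` is not an integer, and its limit as the order tends to `ν` if `ν` is an integer. -/
noncomputable def besselY (ν x : ℝ) : ℝ :=
  if ∃ n : ℤ, (n : ℝ) = ν then
    Filter.limUnder (nhdsWithin ν {ν}ᶜ) (fun μ : ℝ => besselYQuotient μ x)
  else besselYQuotient ν x

/-- The cross product `U_ν(ρ, t) = J_ν(ρ t) Y_ν(ρ b) - J_ν(ρ b) Y_ν(ρ t)`. -/
noncomputable def crossU (b ν ρ t : ℝ) : ℝ :=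
  besselJ ν (ρ * t) * besselY ν (ρ * b) - besselJ ν (ρ * b) * besselY ν (ρ * t)

/-- For `m ≥ 1`, the `m`-th positive zero `ρ_{ν,m}` of `ρ ↦ U_ν(ρ, 1)`, in increasing order: each
is the least zero beyond the previous one. The recursion starts from the auxiliary value `0` at
`m = 0`, which does not belong to the sequence. -/
noncomputable def crossZero (b ν : ℝ) : ℕ → ℝ
  | 0 => 0
  | m + 1 => sInf {ρ : ℝ | crossZero b ν m < ρ ∧ crossU b ν ρ 1 = 0}

/-- The `m`-th term
`U_ν(ρ_{ν,m}, s) U_ν(ρ_{ν,m}, t) / (ρ_{ν,m}² ∫_1^b U_ν(ρ_{ν,m}, τ)² τ dτ)`. -/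
noncomputable def crossTerm (b ν s t : ℝ) (m : ℕ) : ℝ :=
  crossU b ν (crossZero b ν m) s * crossU b ν (crossZero b ν m) t /
    (crossZero b ν m ^ 2 * ∫ τ in (1 : ℝ)..b, crossU b ν (crossZero b ν m) τ ^ 2 * τ)

/-- `ψ_ν(t) = t^ν - t^{-ν}`. -/
noncomputable def psiFun (ν t : ℝ) : ℝ := t ^ ν - t ^ (-ν)

open Filter Topology Set
open scoped RealInnerProductSpace

/-! The substitution `t = b e^{-z}` turns Bessel's equation into `y'' = (ν² - ρ² w) y` with `w(z) =
(b e^{-z})²`, and sends `[1, b]` to `[0, log b]` with reversed orientation. In this variable `U_ν(ρ,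
·)` is the solution with `y(0) = 0` and `y'(0) = 2/π`; the slope is the Wronskian of `J_ν` and
`J_{-ν}` divided by `sin νπ`. Integer orders follow by letting the order tend to `ν`
(`crossU_isIVPSol`). The zeros `ρ_{ν,m}` are thus the square roots of the Dirichlet eigenvalues of
`-y'' + ν² y = λ w y`, and the two series are the eigenfunction expansion of the Green function of
`-y'' + ν² y`, an explicit product `u(min) v(max)` of hyperbolic sines, or of linear functions when
`ν = 0`.

The Green function is realised as a Gram matrix `⟪e x, e z⟫` of a continuous curve `e` in a Hilbert
space (`IsDirichletPair.exists_feature`). The operator `∫ w e ⊗ e` is compact and symmetric, and its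
eigenvectors with nonzero eigenvalue are exactly accounted for by the zeros
(`IsGreenFeature.exists_eq_smul_sturmVec`). A vector killed by it is orthogonal to every `e s`, so
`e s` lies in the closed span of these eigenvectors and has a norm-convergent orthogonal expansion.
Pairing with `e t`, which is bounded in norm, gives uniform convergence in `t` directly.

The same picture controls the zeros: Bessel's inequality bounds `∑ ρ⁻²`, so they are locally finite,
and the kink of the Green function on the diagonal forces infinitely many. -/

/-! ### The power series of `J_ν` and its dependence on argument and order -/

/-- The entire function `g` with `J_ν(x) = (x/2)^ν g(x²/4)`. -/
noncomputable def besselAux (ν w : ℝ) : ℝ :=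
  ∑' k : ℕ, (-1 : ℝ) ^ k / ((k.factorial : ℝ) * Real.Gamma (ν + k + 1)) * w ^ k

theorem Complex.inv_Gamma_eq (z : ℂ) : (Complex.Gamma z)⁻¹ = z * (Complex.Gamma (z + 1))⁻¹ := by
  have := Complex.one_div_Gamma_eq_self_mul_one_div_Gamma_add_one z
  simpa using this

/-- For each `k` the entire function `1/Γ` is bounded on the relevant disc. Once `k ≥ R`, the
functional equation divides by `μ + k + 1`, of modulus at least 1, so the norms no longer grow with
`k`. Uniformity in `μ` is what yields holomorphy in the order. -/
theorem Complex.exists_norm_inv_Gamma_le (R : ℝ) :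
    ∃ C : ℝ, 0 ≤ C ∧ ∀ μ : ℂ, ‖μ‖ ≤ R → ∀ k : ℕ, ‖(Complex.Gamma (μ + k + 1))⁻¹‖ ≤ C := by
  have hk : ∀ k : ℕ, ∃ C : ℝ, ∀ μ ∈ Metric.closedBall (0 : ℂ) R,
      ‖(Complex.Gamma (μ + k + 1))⁻¹‖ ≤ C := by
    intro k
    refine (isCompact_closedBall (0 : ℂ) R).exists_bound_of_continuousOn
      (f := fun μ : ℂ => (Complex.Gamma (μ + k + 1))⁻¹) (Continuous.continuousOn ?_)
    exact Complex.differentiable_one_div_Gamma.continuous.comp (by fun_prop : Continuous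
      fun μ : ℂ => μ + k + 1)
  choose C hC using hk
  obtain ⟨N, hN⟩ := exists_nat_ge R
  refine ⟨∑ k ∈ Finset.range (N + 1), |C k|, Finset.sum_nonneg fun _ _ => abs_nonneg _, ?_⟩
  intro μ hμ k
  have small : ∀ k ≤ N, ‖(Complex.Gamma (μ + k + 1))⁻¹‖ ≤ ∑ k ∈ Finset.range (N + 1), |C k| := by
    intro k hk
    refine (hC k μ (by simpa using hμ)).trans ((le_abs_self _).trans ?_)
    exact Finset.single_le_sum (f := fun k => |C k|) (fun _ _ => abs_nonneg _)
      (Finset.mem_range.2 (by omega))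
  rcases le_total k N with h | h
  · exact small k h
  · induction k, h using Nat.le_induction with
    | base => exact small N le_rfl
    | succ k hk ih =>
      refine le_trans ?_ ih
      rw [Complex.inv_Gamma_eq (μ + k + 1), norm_mul]
      have h1 : (1 : ℝ) ≤ ‖μ + k + 1‖ := by
        have h2 : ‖((k : ℂ) + 1)‖ ≤ ‖μ + k + 1‖ + ‖μ‖ := by
          calc ‖((k : ℂ) + 1)‖ = ‖(μ + k + 1) - μ‖ := by ring_nf
            _ ≤ _ := norm_sub_le _ _
        have h3 : ‖((k : ℂ) + 1)‖ = k + 1 := by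
          have := Complex.norm_natCast (k + 1)
          push_cast at this; exact this
        have : (N : ℝ) ≤ k := by exact_mod_cast hk
        linarith
      push_cast
      rw [← add_assoc]
      exact le_mul_of_one_le_left (norm_nonneg _) h1

theorem Real.exists_abs_inv_Gamma_le (ν : ℝ) :
    ∃ C : ℝ, 0 ≤ C ∧ ∀ k : ℕ, |(Real.Gamma (ν + k + 1))⁻¹| ≤ C := by
  obtain ⟨C, hC0, hC⟩ := Complex.exists_norm_inv_Gamma_le |ν|
  refine ⟨C, hC0, fun k => ?_⟩
  have := hC ν (by simp) k
  have h : (ν : ℂ) + k + 1 = ((ν + k + 1 : ℝ) : ℂ) := by push_cast; ring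
  rw [h, Complex.Gamma_ofReal, ← Complex.ofReal_inv, Complex.norm_real] at this
  exact this

theorem Real.inv_Gamma_eq (z : ℝ) : (Real.Gamma z)⁻¹ = z * (Real.Gamma (z + 1))⁻¹ := by
  have := Complex.inv_Gamma_eq z
  have h : (z : ℂ) + 1 = ((z + 1 : ℝ) : ℂ) := by push_cast; ring
  rw [h, Complex.Gamma_ofReal, Complex.Gamma_ofReal] at this
  exact_mod_cast this

theorem summable_besselAux (ν w : ℝ) : Summable fun k : ℕ =>
    (-1 : ℝ) ^ k / ((k.factorial : ℝ) * Real.Gamma (ν + k + 1)) * w ^ k := by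
  obtain ⟨C, hC0, hC⟩ := Real.exists_abs_inv_Gamma_le ν
  refine Summable.of_norm_bounded (g := fun k : ℕ => C * (|w| ^ k / k.factorial))
    ((Real.summable_pow_div_factorial |w|).mul_left C) fun k => ?_
  have := hC k
  rw [Real.norm_eq_abs, abs_mul, abs_div, abs_mul, abs_pow, abs_neg, abs_one, one_pow, abs_pow,
    Nat.abs_cast]
  rw [abs_inv] at this
  calc 1 / ((k.factorial : ℝ) * |Real.Gamma (ν + k + 1)|) * |w| ^ k
      = |Real.Gamma (ν + k + 1)|⁻¹ * (|w| ^ k / k.factorial) := by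
        rw [one_div, mul_inv]; ring
    _ ≤ _ := by gcongr

theorem hasDerivAt_besselAux (ν w : ℝ) :
    HasDerivAt (besselAux ν) (-besselAux (ν + 1) w) w := by
  obtain ⟨C, hC0, hC⟩ := Real.exists_abs_inv_Gamma_le ν
  set R := |w| + 1 with hR
  have hsucc : ∀ k : ℕ, ∀ y : ℝ, (-1 : ℝ) ^ (k + 1) / (((k + 1).factorial : ℝ) *
      Real.Gamma (ν + (k + 1 : ℕ) + 1)) * (((k + 1 : ℕ) : ℝ) * y ^ k) =
      -((-1 : ℝ) ^ k / ((k.factorial : ℝ) * Real.Gamma (ν + 1 + k + 1)) * y ^ k) := by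
    intro k y
    have h1 : ν + (k + 1 : ℕ) + 1 = ν + 1 + k + 1 := by push_cast; ring
    rw [h1, Nat.factorial_succ]
    have : ((k : ℝ) + 1) ≠ 0 := by positivity
    push_cast
    rw [div_eq_mul_inv, div_eq_mul_inv, mul_inv, mul_inv, mul_inv]
    field_simp
    ring
  have key := hasDerivAt_tsum_of_isPreconnected
    (g := fun (k : ℕ) (y : ℝ) => (-1 : ℝ) ^ k / ((k.factorial : ℝ) * Real.Gamma (ν + k + 1)) * y ^ k)
    (g' := fun (k : ℕ) (y : ℝ) => (-1 : ℝ) ^ k / ((k.factorial : ℝ) * Real.Gamma (ν + k + 1)) *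
      (k * y ^ (k - 1)))
    (u := fun k : ℕ => C * (R ^ (k - 1) / (k - 1).factorial)) (t := Metric.ball 0 R) (y₀ := 0)
    (y := w) ?_ Metric.isOpen_ball (convex_ball _ _).isPreconnected ?_ ?_ (by simp [hR]; positivity)
    (summable_besselAux ν 0) (by simp [hR])
  · have hs : Summable fun k : ℕ => (-1 : ℝ) ^ k / ((k.factorial : ℝ) * Real.Gamma (ν + k + 1)) *
        (k * w ^ (k - 1)) := by
      rw [← summable_nat_add_iff 1]
      simp only [Nat.add_sub_cancel, hsucc]
      exact (summable_besselAux (ν + 1) w).neg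
    have := hs.tsum_eq_zero_add
    rw [this] at key
    simp only [Nat.add_sub_cancel, hsucc, tsum_neg] at key
    refine key.congr_deriv ?_
    simp [besselAux]
  · rw [← summable_nat_add_iff 1]
    exact (Real.summable_pow_div_factorial R).mul_left C
  · intro k y _
    exact (hasDerivAt_pow k y).const_mul _
  · intro k y hy
    have hy : |y| ≤ R := by simpa using (Metric.mem_ball.1 hy).le
    rcases k with _ | k
    · simp; positivity
    rw [Nat.add_sub_cancel, hsucc, norm_neg, Real.norm_eq_abs, abs_mul, abs_div, abs_mul, abs_pow,
      abs_neg, abs_one, one_pow, abs_pow, Nat.abs_cast]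
    have := hC (k + 1)
    rw [abs_inv] at this
    have h1 : ν + (k + 1 : ℕ) + 1 = ν + 1 + k + 1 := by push_cast; ring
    rw [h1] at this
    calc 1 / ((k.factorial : ℝ) * |Real.Gamma (ν + 1 + k + 1)|) * |y| ^ k
        = |Real.Gamma (ν + 1 + k + 1)|⁻¹ * (|y| ^ k / k.factorial) := by
          rw [one_div, mul_inv]; ring
      _ ≤ _ := by gcongr

/-- Coefficientwise this is the functional equation of `1/Γ`, valid also at the poles. Since `g_ν' =
-g_{ν+1}`, it is the differential equation `w g'' + (ν + 1) g' + g = 0`. -/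
theorem mul_besselAux_add_two (ν w : ℝ) :
    w * besselAux (ν + 2) w = (ν + 1) * besselAux (ν + 1) w - besselAux ν w := by
  have h0 := summable_besselAux ν w
  have h1 := (summable_besselAux (ν + 1) w).mul_left (ν + 1)
  unfold besselAux
  rw [← tsum_mul_left, ← tsum_mul_left, ← h1.tsum_sub h0, (h1.sub h0).tsum_eq_zero_add]
  have hz : (ν + 1) * ((-1 : ℝ) ^ 0 / ((Nat.factorial 0 : ℝ) * Real.Gamma (ν + 1 + (0 : ℕ) + 1)) *
      w ^ 0) - (-1 : ℝ) ^ 0 / ((Nat.factorial 0 : ℝ) * Real.Gamma (ν + (0 : ℕ) + 1)) * w ^ 0 = 0 := by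
    have := Real.inv_Gamma_eq (ν + 1)
    simp [this]
  rw [hz, zero_add]
  refine tsum_congr fun k => ?_
  have e1 : ν + 2 + (k : ℝ) + 1 = ν + k + 3 := by ring
  have e2 : ν + 1 + ((k + 1 : ℕ) : ℝ) + 1 = ν + k + 3 := by push_cast; ring
  have e3 : ν + ((k + 1 : ℕ) : ℝ) + 1 = ν + k + 2 := by push_cast; ring
  have e4 : ν + k + 2 + 1 = ν + k + 3 := by ring
  have := Real.inv_Gamma_eq (ν + k + 2)
  rw [e4] at this
  rw [e1, e2, e3, Nat.factorial_succ]
  simp only [div_eq_mul_inv, mul_inv, this]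
  have : ((k : ℝ) + 1) ≠ 0 := by positivity
  push_cast
  field_simp
  ring

theorem besselAux_zero (ν : ℝ) : besselAux ν 0 = (Real.Gamma (ν + 1))⁻¹ := by
  unfold besselAux
  rw [tsum_eq_single 0]
  · simp
  · intro k hk
    simp [hk]

theorem besselJ_eq (ν : ℝ) {x : ℝ} (hx : 0 < x) :
    besselJ ν x = (x / 2) ^ ν * besselAux ν (x ^ 2 / 4) := by
  unfold besselJ besselAux
  rw [← tsum_mul_left]
  refine tsum_congr fun k => ?_
  rw [Real.rpow_add (by positivity)]
  have : (x / 2) ^ (2 * (k : ℝ)) = (x ^ 2 / 4) ^ k := by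
    rw [Real.rpow_mul (by positivity), Real.rpow_natCast, Real.rpow_two]
    congr 1; ring
  rw [this]; ring

/-- The first `n` terms sit at poles of `Γ` and vanish; shifting the index gives the rest. This is
`J_{-n} = (-1)^n J_n` without the power factor. -/
theorem besselAux_neg_natCast (n : ℕ) (w : ℝ) :
    besselAux (-n) w = (-w) ^ n * besselAux n w := by
  unfold besselAux
  rw [← (summable_besselAux (-n) w).sum_add_tsum_nat_add n, Finset.sum_eq_zero, zero_add,
    ← tsum_mul_left]
  · refine tsum_congr fun k => ?_
    have e1 : -(n : ℝ) + ((k + n : ℕ) : ℝ) + 1 = k + 1 := by push_cast; ring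
    have e2 : (n : ℝ) + k + 1 = ((k + n : ℕ) : ℝ) + 1 := by push_cast; ring
    rw [e1, e2, Real.Gamma_nat_eq_factorial, Real.Gamma_nat_eq_factorial, pow_add, pow_add, neg_pow w]
    ring
  · intro k hk
    have hk := Finset.mem_range.1 hk
    have : -(n : ℝ) + k + 1 = -((n - k - 1 : ℕ) : ℝ) := by
      rw [Nat.cast_sub (by omega), Nat.cast_sub (by omega)]; push_cast; ring
    rw [this, Real.Gamma_neg_nat_eq_zero]
    simp

/-- For complex order the series converges uniformly on discs, with entire terms, so the sum is
holomorphic; real differentiability follows by restriction. -/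
theorem differentiable_besselAux_order (w : ℝ) : Differentiable ℝ fun ν => besselAux ν w := by
  intro ν
  set R := |ν| + 1 with hR
  obtain ⟨C, hC0, hC⟩ := Complex.exists_norm_inv_Gamma_le R
  set F : ℕ → ℂ → ℂ := fun k μ => (-1) ^ k / k.factorial * (w : ℂ) ^ k *
    (Complex.Gamma (μ + k + 1))⁻¹ with hF
  have hd : DifferentiableOn ℂ (fun μ => ∑' k, F k μ) (Metric.ball 0 R) := by
    refine Complex.differentiableOn_tsum_of_summable_norm
      (u := fun k : ℕ => C * (|w| ^ k / k.factorial))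
      ((Real.summable_pow_div_factorial |w|).mul_left C) ?_ Metric.isOpen_ball ?_
    · intro k
      refine Differentiable.differentiableOn ?_
      exact (Complex.differentiable_one_div_Gamma.comp (by fun_prop : Differentiable ℂ
        fun μ : ℂ => μ + k + 1)).const_mul _
    · intro k μ hμ
      have := hC μ (by simpa using (Metric.mem_ball.1 hμ).le) k
      simp only [hF, norm_mul, norm_div, norm_pow, norm_neg, norm_one, one_pow, Complex.norm_natCast,
        Complex.norm_real, Real.norm_eq_abs]
      calc _ = ‖(Complex.Gamma (μ + k + 1))⁻¹‖ * (|w| ^ k / k.factorial) := by ring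
        _ ≤ _ := by gcongr
  have hdat := (hd ν (by simp [hR])).differentiableAt (Metric.isOpen_ball.mem_nhds (by simp [hR]))
  have hre := hdat.hasDerivAt.real_of_complex
  have : (fun ν : ℝ => besselAux ν w) = fun x : ℝ => (∑' k, F k x).re := by
    funext x
    have : ∑' k, F k x = ((besselAux x w : ℝ) : ℂ) := by
      unfold besselAux
      rw [Complex.ofReal_tsum]
      refine tsum_congr fun k => ?_
      have h : (x : ℂ) + k + 1 = ((x + k + 1 : ℝ) : ℂ) := by push_cast; ring
      simp only [hF]
      rw [h, Complex.Gamma_ofReal]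
      push_cast
      rw [div_eq_mul_inv, div_eq_mul_inv, mul_inv]; ring
    rw [this, Complex.ofReal_re]
  rw [this]
  exact hre.differentiableAt

theorem differentiable_besselJ_order {x : ℝ} (hx : 0 < x) :
    Differentiable ℝ fun ν => besselJ ν x := by
  simp only [besselJ_eq _ hx]
  have h : Differentiable ℝ fun ν : ℝ => (x / 2) ^ ν := fun ν =>
    (Real.hasStrictDerivAt_const_rpow (by positivity : 0 < x / 2) ν).hasDerivAt.differentiableAt
  exact h.mul (differentiable_besselAux_order _)

/-! ### Bessel's equation and the Wronskian in the exponential variable -/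

/-- The derivative of `z ↦ J_ν(c e^{-z})`. -/
noncomputable def besselJExpDeriv (c ν z : ℝ) : ℝ :=
  -((c * Real.exp (-z) / 2) ^ ν * (ν * besselAux ν ((c * Real.exp (-z)) ^ 2 / 4) -
    2 * ((c * Real.exp (-z)) ^ 2 / 4) * besselAux (ν + 1) ((c * Real.exp (-z)) ^ 2 / 4)))

theorem hasDerivAt_mul_exp_neg (c z : ℝ) :
    HasDerivAt (fun z => c * Real.exp (-z)) (-(c * Real.exp (-z))) z := by
  simpa using ((hasDerivAt_neg z).exp).const_mul c

theorem hasDerivAt_rpow_mul_exp_neg {c : ℝ} (hc : 0 < c) (ν z : ℝ) :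
    HasDerivAt (fun z => (c * Real.exp (-z) / 2) ^ ν) (-ν * (c * Real.exp (-z) / 2) ^ ν) z := by
  have hp : 0 < c * Real.exp (-z) / 2 := by positivity
  refine (((hasDerivAt_mul_exp_neg c z).div_const 2).rpow_const (Or.inl hp.ne')).congr_deriv ?_
  rw [Real.rpow_sub_one hp.ne']
  field_simp

theorem hasDerivAt_sq_mul_exp_neg (c z : ℝ) :
    HasDerivAt (fun z => (c * Real.exp (-z)) ^ 2 / 4) (-2 * ((c * Real.exp (-z)) ^ 2 / 4)) z := by
  refine (((hasDerivAt_mul_exp_neg c z).pow 2).div_const 4).congr_deriv ?_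
  push_cast
  ring

theorem hasDerivAt_besselAux_exp (c ν z : ℝ) :
    HasDerivAt (fun z => besselAux ν ((c * Real.exp (-z)) ^ 2 / 4))
      (2 * ((c * Real.exp (-z)) ^ 2 / 4) * besselAux (ν + 1) ((c * Real.exp (-z)) ^ 2 / 4)) z := by
  refine ((hasDerivAt_besselAux ν _).comp z (hasDerivAt_sq_mul_exp_neg c z)).congr_deriv ?_
  ring

theorem hasDerivAt_besselJ_exp {c : ℝ} (hc : 0 < c) (ν z : ℝ) :
    HasDerivAt (fun z => besselJ ν (c * Real.exp (-z))) (besselJExpDeriv c ν z) z := by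
  have : (fun z => besselJ ν (c * Real.exp (-z))) = fun z => (c * Real.exp (-z) / 2) ^ ν *
      besselAux ν ((c * Real.exp (-z)) ^ 2 / 4) := by
    funext z
    exact besselJ_eq ν (by positivity)
  rw [this]
  refine ((hasDerivAt_rpow_mul_exp_neg hc ν z).mul (hasDerivAt_besselAux_exp c ν z)).congr_deriv ?_
  unfold besselJExpDeriv
  ring

/-- With `x = c e^{-z}` one has `x d/dx = -d/dz`, so Bessel's equation loses its first-order term.
-/
theorem hasDerivAt_besselJExpDeriv {c : ℝ} (hc : 0 < c) (ν z : ℝ) :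
    HasDerivAt (besselJExpDeriv c ν)
      ((ν ^ 2 - (c * Real.exp (-z)) ^ 2) * besselJ ν (c * Real.exp (-z))) z := by
  have h := ((hasDerivAt_rpow_mul_exp_neg hc ν z).mul
    (((hasDerivAt_besselAux_exp c ν z).const_mul ν).sub
      (((hasDerivAt_sq_mul_exp_neg c z).const_mul 2).mul
        (hasDerivAt_besselAux_exp c (ν + 1) z)))).neg
  refine h.congr_deriv ?_
  rw [besselJ_eq ν (by positivity : 0 < c * Real.exp (-z))]
  have hrec := mul_besselAux_add_two ν ((c * Real.exp (-z)) ^ 2 / 4)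
  rw [show ν + 1 + 1 = ν + 2 by ring]
  simp only [Pi.mul_apply, Pi.sub_apply]
  linear_combination 4 * (c * Real.exp (-z) / 2) ^ ν * ((c * Real.exp (-z)) ^ 2 / 4) * hrec

/-- The left side is the Wronskian of `J_μ` and `J_{-μ}`, up to sign, after the powers cancel. The
recurrence makes its derivative zero; its value at `w = 0` comes from the reflection formula for
`Γ`. -/
theorem besselAux_wronskian (μ w : ℝ) :
    -(2 * μ) * (besselAux μ w * besselAux (-μ) w) - 2 * w * (besselAux μ w * besselAux (-μ + 1) w) +
      2 * w * (besselAux (μ + 1) w * besselAux (-μ) w) = -(2 * Real.sin (μ * Real.pi) / Real.pi) := by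
  set H : ℝ → ℝ := fun w => -(2 * μ) * (besselAux μ w * besselAux (-μ) w) -
    2 * w * (besselAux μ w * besselAux (-μ + 1) w) +
    2 * w * (besselAux (μ + 1) w * besselAux (-μ) w) with hH
  have hder : ∀ w, HasDerivAt H 0 w := by
    intro w
    have d0 := hasDerivAt_besselAux μ w
    have d1 := hasDerivAt_besselAux (-μ) w
    have d2 := hasDerivAt_besselAux (μ + 1) w
    have d3 := hasDerivAt_besselAux (-μ + 1) w
    have hw : HasDerivAt (fun w : ℝ => 2 * w) 2 w := by simpa using (hasDerivAt_id w).const_mul 2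
    refine ((((d0.mul d1).const_mul (-(2 * μ))).sub (hw.mul (d0.mul d3))).add
      (hw.mul (d2.mul d1))).congr_deriv ?_
    have r1 := mul_besselAux_add_two μ w
    have r2 := mul_besselAux_add_two (-μ) w
    rw [show μ + 1 + 1 = μ + 2 by ring, show -μ + 1 + 1 = -μ + 2 by ring]
    simp only [Pi.mul_apply]
    linear_combination 2 * besselAux μ w * r2 - 2 * besselAux (-μ) w * r1
  have hconst : H w = H 0 := is_const_of_deriv_eq_zero (fun w => (hder w).differentiableAt)
    (fun w => (hder w).deriv) w 0
  change H w = _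
  rw [hconst]
  simp only [hH, mul_zero, zero_mul, sub_zero, add_zero, besselAux_zero]
  rcases eq_or_ne μ 0 with rfl | hμ
  · simp
  have hΓ := Real.Gamma_mul_Gamma_one_sub μ
  have e := Real.inv_Gamma_eq μ
  have e2 : -μ + 1 = 1 - μ := by ring
  have : μ * ((Real.Gamma (μ + 1))⁻¹ * (Real.Gamma (1 - μ))⁻¹) =
      Real.sin (μ * Real.pi) / Real.pi := by
    rw [← mul_assoc, ← e, ← mul_inv, hΓ, inv_div, mul_comm μ]
  rw [e2]
  linear_combination (-2) * this

theorem besselJ_exp_wronskian {c : ℝ} (hc : 0 < c) (μ z : ℝ) :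
    besselJ μ (c * Real.exp (-z)) * besselJExpDeriv c (-μ) z -
      besselJExpDeriv c μ z * besselJ (-μ) (c * Real.exp (-z)) =
      2 * Real.sin (μ * Real.pi) / Real.pi := by
  have hp : 0 < c * Real.exp (-z) := by positivity
  rw [besselJ_eq _ hp, besselJ_eq _ hp]
  unfold besselJExpDeriv
  have hpow : (c * Real.exp (-z) / 2) ^ μ * (c * Real.exp (-z) / 2) ^ (-μ) = 1 := by
    rw [← Real.rpow_add (by positivity), add_neg_cancel, Real.rpow_zero]
  have hW := besselAux_wronskian μ ((c * Real.exp (-z)) ^ 2 / 4)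
  generalize (c * Real.exp (-z) / 2) ^ μ = p at *
  generalize (c * Real.exp (-z) / 2) ^ (-μ) = q at *
  generalize (c * Real.exp (-z)) ^ 2 / 4 = w at *
  linear_combination (-p * q) * hW + (2 * Real.sin (μ * Real.pi) / Real.pi) * hpow

/-! ### The cross product as a solution of an initial value problem -/

theorem crossU_eq_of_not_int {ν : ℝ} (hν : ¬ ∃ n : ℤ, (n : ℝ) = ν) (b ρ t : ℝ) :
    crossU b ν ρ t = (besselJ ν (ρ * b) * besselJ (-ν) (ρ * t) -
      besselJ ν (ρ * t) * besselJ (-ν) (ρ * b)) / Real.sin (ν * Real.pi) := by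
  simp only [crossU, besselY, if_neg hν, besselYQuotient]
  ring

/-- The derivative of `z ↦ U_ν(ρ, b e^{-z})` for non-integer `ν`. -/
noncomputable def crossUExpDeriv (b ν ρ z : ℝ) : ℝ :=
  (besselJ ν (ρ * b) * besselJExpDeriv (ρ * b) (-ν) z -
      besselJExpDeriv (ρ * b) ν z * besselJ (-ν) (ρ * b)) / Real.sin (ν * Real.pi)

theorem crossU_self (b ν ρ : ℝ) : crossU b ν ρ b = 0 := by
  unfold crossU; ring

/-- `y` with derivative `y'` is the solution of `y'' = q y`, `y(0) = 0`, `y'(0) = a`. -/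
structure IsIVPSol (q : ℝ → ℝ) (a : ℝ) (y y' : ℝ → ℝ) : Prop where
  hasDerivAt : ∀ z, HasDerivAt y (y' z) z
  hasDerivAt' : ∀ z, HasDerivAt y' (q z * y z) z
  zero : y 0 = 0
  zero' : y' 0 = a

/-- The factor `sin νπ` of the Wronskian cancels the denominator, so the initial slope depends
neither on `ν` nor on `ρ` and survives the passage to integer order. -/
theorem crossU_isIVPSol_of_not_int {b ν ρ : ℝ} (hb : 0 < b) (hρ : 0 < ρ)
    (hν : ¬ ∃ n : ℤ, (n : ℝ) = ν) :
    IsIVPSol (fun z => ν ^ 2 - (ρ * b * Real.exp (-z)) ^ 2) (2 / Real.pi)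
      (fun z => crossU b ν ρ (b * Real.exp (-z))) (crossUExpDeriv b ν ρ) := by
  have hc : 0 < ρ * b := by positivity
  have hsin : Real.sin (ν * Real.pi) ≠ 0 := by
    intro h
    obtain ⟨n, hn⟩ := Real.sin_eq_zero_iff.1 h
    exact hν ⟨n, mul_right_cancel₀ Real.pi_ne_zero hn⟩
  refine ⟨fun z => ?_, fun z => ?_, ?_, ?_⟩
  · have : (fun z => crossU b ν ρ (b * Real.exp (-z))) = fun z =>
        (besselJ ν (ρ * b) * besselJ (-ν) (ρ * b * Real.exp (-z)) -
      besselJ ν (ρ * b * Real.exp (-z)) * besselJ (-ν) (ρ * b)) / Real.sin (ν * Real.pi) := by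
      funext z
      rw [crossU_eq_of_not_int hν, ← mul_assoc]
    rw [this]
    exact (((hasDerivAt_besselJ_exp hc (-ν) z).const_mul _).sub
      ((hasDerivAt_besselJ_exp hc ν z).mul_const _)).div_const _
  · refine ((((hasDerivAt_besselJExpDeriv hc (-ν) z).const_mul _).sub
      ((hasDerivAt_besselJExpDeriv hc ν z).mul_const _)).div_const _).congr_deriv ?_
    rw [crossU_eq_of_not_int hν]
    simp only [← mul_assoc]
    ring
  · simp [crossU_self]
  · have := besselJ_exp_wronskian hc ν 0
    simp only [neg_zero, Real.exp_zero, mul_one] at this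
    unfold crossUExpDeriv
    rw [this]
    field_simp

/-! ### Integer orders as limits -/

/-- Numerator and `sin μπ` both vanish at `n`, so the quotient is a ratio of slopes; the derivative
of the sine there is `±π`. Existence of this limit gives `limUnder` its meaning in `besselY`. -/
theorem tendsto_besselYQuotient (n : ℕ) {x : ℝ} (hx : 0 < x) :
    ∃ l, Tendsto (fun μ => besselYQuotient μ x) (𝓝[≠] (n : ℝ)) (𝓝 l) := by
  have hd := differentiable_besselJ_order hx
  set N : ℝ → ℝ := fun μ => besselJ μ x * Real.cos (μ * Real.pi) - besselJ (-μ) x with hN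
  have hNd : Differentiable ℝ N := by
    refine (hd.mul ?_).sub (hd.comp differentiable_neg)
    fun_prop
  have hN0 : N n = 0 := by
    have h : besselJ (-n) x = (-1) ^ n * besselJ n x := by
      rw [besselJ_eq _ hx, besselJ_eq _ hx, besselAux_neg_natCast, Real.rpow_neg (by positivity),
        Real.rpow_natCast]
      have : (-(x ^ 2 / 4)) ^ n = (-1) ^ n * ((x / 2) ^ n * (x / 2) ^ n) := by
        rw [← mul_pow, ← mul_pow]; congr 1; ring
      rw [this]
      have : (x / 2) ^ n ≠ 0 := by positivity
      field_simp
    simp only [hN]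
    rw [h, Real.cos_nat_mul_pi]; ring
  have hS : HasDerivAt (fun μ => Real.sin (μ * Real.pi)) (Real.cos (n * Real.pi) * Real.pi) n := by
    simpa using ((hasDerivAt_id (n : ℝ)).mul_const Real.pi).sin
  have h1 := (hNd n).hasDerivAt.tendsto_slope
  have h2 := hS.tendsto_slope
  have hne : Real.cos (n * Real.pi) * Real.pi ≠ 0 := by
    rw [Real.cos_nat_mul_pi]
    exact mul_ne_zero (pow_ne_zero _ (by norm_num)) Real.pi_ne_zero
  refine ⟨_, (h1.div h2 hne).congr' ?_⟩
  filter_upwards [self_mem_nhdsWithin] with μ hμ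
  have hμ : μ - n ≠ 0 := sub_ne_zero.2 hμ
  rw [Pi.div_apply, slope_def_field, slope_def_field, hN0, Real.sin_nat_mul_pi, sub_zero, sub_zero,
    div_div_div_cancel_right₀ hμ]
  rfl

theorem eventually_not_int (n : ℕ) : ∀ᶠ μ in 𝓝[≠] (n : ℝ), ¬ ∃ k : ℤ, (k : ℝ) = μ := by
  rw [eventually_nhdsWithin_iff]
  filter_upwards [Metric.ball_mem_nhds (n : ℝ) one_pos] with μ hμ hne
  rintro ⟨k, rfl⟩
  rw [Metric.mem_ball, Real.dist_eq] at hμ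
  have : |k - (n : ℤ)| < 1 := by exact_mod_cast hμ
  have h2 := Int.abs_lt_one_iff.1 this
  apply hne
  rw [Set.mem_singleton_iff]
  have : k = n := by omega
  exact_mod_cast this

theorem tendsto_besselY (n : ℕ) {x : ℝ} (hx : 0 < x) :
    Tendsto (fun μ => besselY μ x) (𝓝[≠] (n : ℝ)) (𝓝 (besselY n x)) := by
  obtain ⟨l, hl⟩ := tendsto_besselYQuotient n hx
  have : besselY n x = l := by
    rw [besselY, if_pos ⟨n, by simp⟩]
    exact hl.limUnder_eq
  rw [this]
  refine hl.congr' ?_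
  filter_upwards [eventually_not_int n] with μ hμ
  rw [besselY, if_neg hμ]

theorem tendsto_crossU (n : ℕ) {b ρ t : ℝ} (hb : 0 < b) (hρ : 0 < ρ) (ht : 0 < t) :
    Tendsto (fun μ => crossU b μ ρ t) (𝓝[≠] (n : ℝ)) (𝓝 (crossU b n ρ t)) := by
  have hJ : ∀ {x : ℝ}, 0 < x → Tendsto (fun μ => besselJ μ x) (𝓝[≠] (n : ℝ)) (𝓝 (besselJ n x)) :=
    fun hx => ((differentiable_besselJ_order hx).continuous.tendsto _).mono_left nhdsWithin_le_nhds
  have h1 : 0 < ρ * t := by positivity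
  have h2 : 0 < ρ * b := by positivity
  exact ((hJ h1).mul (tendsto_besselY n h2)).sub ((hJ h2).mul (tendsto_besselY n h1))

theorem IsIVPSol.neg {q : ℝ → ℝ} {a : ℝ} {y y' : ℝ → ℝ} (h : IsIVPSol q a y y') :
    IsIVPSol (fun z => q (-z)) (-a) (fun z => y (-z)) (fun z => -y' (-z)) := by
  refine ⟨fun z => ?_, fun z => ?_, by simp [h.zero], by simp [h.zero']⟩
  · exact ((h.hasDerivAt (-z)).comp z (hasDerivAt_neg z)).congr_deriv (by simp)
  · exact ((h.hasDerivAt' (-z)).comp z (hasDerivAt_neg z)).neg.congr_deriv (by simp)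

/-- Growth bound for a solution of `y'' = q y` on `[0, M]` with `y(0) = 0`. -/
theorem sq_add_sq_le_of_hasDerivAt {q : ℝ → ℝ} {K M : ℝ} {y y' : ℝ → ℝ}
    (h : ∀ z ∈ Set.Icc 0 M, HasDerivAt y (y' z) z)
    (h' : ∀ z ∈ Set.Icc 0 M, HasDerivAt y' (q z * y z) z) (h0 : y 0 = 0)
    (hq : ∀ z ∈ Set.Icc 0 M, |q z| ≤ K) {z : ℝ} (hz : z ∈ Set.Icc 0 M) :
    y z ^ 2 + y' z ^ 2 ≤ y' 0 ^ 2 * Real.exp ((1 + K) * z) := by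
  -- Since `|2 y y' (1 + q)| ≤ (1 + K)(y² + y'²)`, this exponential weight makes the energy
  -- nonincreasing.
  set E : ℝ → ℝ := fun z => (y z ^ 2 + y' z ^ 2) * Real.exp (-((1 + K) * z)) with hE
  have hd : ∀ z ∈ Set.Icc 0 M, HasDerivAt E ((2 * y z * y' z + 2 * y' z * (q z * y z) -
      (1 + K) * (y z ^ 2 + y' z ^ 2)) * Real.exp (-((1 + K) * z))) z := by
    intro z hz
    have e1 : HasDerivAt (fun z => Real.exp (-((1 + K) * z)))
        (Real.exp (-((1 + K) * z)) * (-((1 + K)))) z := by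
      simpa using ((hasDerivAt_id z).const_mul (1 + K)).neg.exp
    refine ((((h z hz).pow 2).add ((h' z hz).pow 2)).mul e1).congr_deriv ?_
    simp only [Pi.add_apply, Pi.pow_apply]
    push_cast
    ring
  have hanti : AntitoneOn E (Set.Icc 0 M) := by
    refine antitoneOn_of_deriv_nonpos (convex_Icc 0 M)
      (fun z hz => (hd z hz).continuousAt.continuousWithinAt)
      (fun z hz => (hd z (interior_subset hz)).differentiableAt.differentiableWithinAt)
      fun z hz => ?_
    have hz := interior_subset hz
    rw [(hd z hz).deriv]
    refine mul_nonpos_of_nonpos_of_nonneg ?_ (Real.exp_pos _).le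
    have h1 : 2 * y z * y' z * q z ≤ (y z ^ 2 + y' z ^ 2) * K := by
      have h2 : |2 * y z * y' z| ≤ y z ^ 2 + y' z ^ 2 := by
        rw [abs_le]; constructor <;> nlinarith [sq_nonneg (y z + y' z), sq_nonneg (y z - y' z)]
      calc 2 * y z * y' z * q z ≤ |2 * y z * y' z * q z| := le_abs_self _
        _ = |2 * y z * y' z| * |q z| := abs_mul _ _
        _ ≤ _ := mul_le_mul h2 (hq z hz) (abs_nonneg _) (by positivity)
    nlinarith [sq_nonneg (y z - y' z)]
  have := hanti ⟨le_rfl, hz.1.trans hz.2⟩ hz hz.1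
  simp only [hE, h0, mul_zero, neg_zero, Real.exp_zero, mul_one] at this
  rw [Real.exp_neg, ← div_eq_mul_inv, div_le_iff₀ (Real.exp_pos _)] at this
  simpa using this

theorem eq_zero_of_hasDerivAt {q : ℝ → ℝ} {M : ℝ} {y y' : ℝ → ℝ}
    (h : ∀ z ∈ Set.Icc 0 M, HasDerivAt y (y' z) z)
    (h' : ∀ z ∈ Set.Icc 0 M, HasDerivAt y' (q z * y z) z) (h0 : y 0 = 0) (h0' : y' 0 = 0)
    (hq : Continuous q) {z : ℝ} (hz : z ∈ Set.Icc 0 M) : y z = 0 := by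
  obtain ⟨K, hK⟩ := (isCompact_Icc (a := 0) (b := M)).exists_bound_of_continuousOn hq.continuousOn
  have := sq_add_sq_le_of_hasDerivAt h h' h0 hK hz
  have h2 : y z ^ 2 + y' z ^ 2 ≤ 0 := by simpa [h0'] using this
  nlinarith [sq_nonneg (y z), sq_nonneg (y' z)]

theorem IsIVPSol.sq_add_sq_le_of_nonneg {q : ℝ → ℝ} {a K M : ℝ} {y y' : ℝ → ℝ}
    (h : IsIVPSol q a y y') (hq : ∀ z, |z| ≤ M → |q z| ≤ K) {z : ℝ} (hz0 : 0 ≤ z) (hz : z ≤ M) :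
    y z ^ 2 + y' z ^ 2 ≤ a ^ 2 * Real.exp ((1 + K) * z) := by
  rw [← h.zero']
  exact sq_add_sq_le_of_hasDerivAt (fun z _ => h.hasDerivAt z) (fun z _ => h.hasDerivAt' z) h.zero
    (fun z hz => hq z (by rw [abs_of_nonneg hz.1]; exact hz.2)) ⟨hz0, hz⟩

theorem IsIVPSol.sq_add_sq_le {q : ℝ → ℝ} {a K M : ℝ} {y y' : ℝ → ℝ}
    (h : IsIVPSol q a y y') (hq : ∀ z, |z| ≤ M → |q z| ≤ K) {z : ℝ} (hz : |z| ≤ M) :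
    y z ^ 2 + y' z ^ 2 ≤ a ^ 2 * Real.exp ((1 + K) * |z|) := by
  rcases le_total 0 z with h0 | h0
  · rw [abs_of_nonneg h0] at hz ⊢
    exact h.sq_add_sq_le_of_nonneg hq h0 hz
  · rw [abs_of_nonpos h0] at hz ⊢
    have := h.neg.sq_add_sq_le_of_nonneg (K := K) (M := M) (fun z hz => hq _ (by rwa [abs_neg]))
      (neg_nonneg.2 h0) hz
    simpa using this

/-- A pointwise limit of solutions of initial value problems whose coefficients converge and are
locally uniformly bounded solves the limiting initial value problem. -/
theorem exists_isIVPSol_of_tendsto {ι : Type*} {l : Filter ι} [l.NeBot] [l.IsCountablyGenerated]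
    {q : ι → ℝ → ℝ} {y y' : ι → ℝ → ℝ} {a : ℝ} {q₀ y₀ : ℝ → ℝ}
    (hsol : ∀ᶠ i in l, IsIVPSol (q i) a (y i) (y' i)) (hq₀ : Continuous q₀)
    (hqc : ∀ i, Continuous (q i))
    (hq : ∀ z, Tendsto (fun i => q i z) l (𝓝 (q₀ z)))
    (hbd : ∀ M, ∃ K, ∀ᶠ i in l, ∀ z, |z| ≤ M → |q i z| ≤ K)
    (hy : ∀ z, Tendsto (fun i => y i z) l (𝓝 (y₀ z))) :
    ∃ y₀', IsIVPSol q₀ a y₀ y₀' := by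
  -- local bounds
  have hB : ∀ M, 0 ≤ M → ∃ B, 0 ≤ B ∧ ∀ᶠ i in l, ∀ z, |z| ≤ M →
      |y i z| ≤ B ∧ |y' i z| ≤ B ∧ |q i z * y i z| ≤ B := by
    intro M hM
    obtain ⟨K, hK⟩ := hbd M
    set K' := max K 0
    set D := Real.sqrt (a ^ 2 * Real.exp ((1 + K') * M)) with hD
    refine ⟨D + K' * D, by positivity, ?_⟩
    filter_upwards [hsol, hK] with i hi hKi z hz
    have h1 := hi.sq_add_sq_le (K := K') (M := M)
      (fun z hz => (hKi z hz).trans (le_max_left _ _)) hz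
    have h2 : a ^ 2 * Real.exp ((1 + K') * |z|) ≤ a ^ 2 * Real.exp ((1 + K') * M) := by
      gcongr
    have h3 : |y i z| ≤ D := Real.abs_le_sqrt (by nlinarith [sq_nonneg (y' i z)])
    have h4 : |y' i z| ≤ D := Real.abs_le_sqrt (by nlinarith [sq_nonneg (y i z)])
    have h5 : |q i z * y i z| ≤ K' * D := by
      rw [abs_mul]
      exact mul_le_mul ((hKi z hz).trans (le_max_left _ _)) h3 (abs_nonneg _) (le_max_right _ _)
    have h6 : 0 ≤ K' * D := by positivity
    have h7 : 0 ≤ D := by positivity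
    exact ⟨by linarith, by linarith, by linarith⟩
  -- The uniform bound on `y' i` makes the functions equi-Lipschitz on bounded intervals, and the
  -- pointwise limit inherits this.
  have hcont : Continuous y₀ := by
    rw [continuous_iff_continuousAt]
    intro z
    obtain ⟨B, hB0, hBi⟩ := hB (|z| + 1) (by positivity)
    have hlip : ∀ x, |x| ≤ |z| + 1 → |y₀ x - y₀ z| ≤ B * |x - z| := by
      intro x hx
      refine le_of_tendsto ((hy x).sub (hy z)).abs ?_
      filter_upwards [hBi, hsol] with i hi hs
      exact (convex_Icc (-(|z| + 1)) (|z| + 1)).norm_image_sub_le_of_norm_hasDerivWithin_le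
        (f := y i) (f' := y' i) (C := B) (fun u _ => (hs.hasDerivAt u).hasDerivWithinAt)
        (fun u hu => (hi u (abs_le.2 hu)).2.1) (abs_le.1 (by linarith : |z| ≤ |z| + 1))
        (abs_le.1 hx)
    rw [ContinuousAt, tendsto_iff_norm_sub_tendsto_zero]
    have ht : Tendsto (fun x => B * |x - z|) (𝓝 z) (𝓝 0) := by
      have : Continuous fun x => B * |x - z| := by fun_prop
      simpa using this.tendsto z
    refine squeeze_zero' (Eventually.of_forall fun x => norm_nonneg _) ?_ ht
    filter_upwards [Metric.ball_mem_nhds z one_pos] with x hx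
    refine hlip x ?_
    have h1 : |x - z| < 1 := by rwa [Metric.mem_ball, Real.dist_eq] at hx
    have h2 := abs_sub_abs_le_abs_sub x z
    linarith
  have hintd : ∀ z, ∀ u ∈ Set.uIoc (0 : ℝ) z, |u| ≤ |z| := by
    intro z u hu
    have := Set.uIoc_subset_uIcc hu
    rw [Set.mem_uIcc] at this
    rcases this with h | h
    · exact abs_le_abs_of_nonneg h.1 h.2
    · exact abs_le_abs_of_nonpos h.2 h.1
  -- The candidate for `y₀'`: passing to the limit in `y' i z = a + ∫ q i * y i` by dominated
  -- convergence; integrating once more recovers `y₀`.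
  set p : ℝ → ℝ := fun z => a + ∫ u in (0 : ℝ)..z, q₀ u * y₀ u with hp
  have hpd : ∀ z, HasDerivAt p (q₀ z * y₀ z) z := fun z =>
    ((hq₀.mul hcont).integral_hasStrictDerivAt 0 z).hasDerivAt.const_add a
  have hpc : Continuous p := continuous_iff_continuousAt.2 fun z => (hpd z).continuousAt
  have hlim' : ∀ z, Tendsto (fun i => y' i z) l (𝓝 (p z)) := by
    intro z
    obtain ⟨B, hB0, hBi⟩ := hB |z| (abs_nonneg z)
    have ht : Tendsto (fun i => ∫ u in (0 : ℝ)..z, q i u * y i u) l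
        (𝓝 (∫ u in (0 : ℝ)..z, q₀ u * y₀ u)) := by
      refine intervalIntegral.tendsto_integral_filter_of_dominated_convergence (fun _ => B) ?_ ?_
        intervalIntegrable_const ?_
      · filter_upwards [hsol] with i hi
        have : Continuous (y i) := continuous_iff_continuousAt.2 fun z => (hi.hasDerivAt z).continuousAt
        exact ((hqc i).mul this).aestronglyMeasurable
      · filter_upwards [hBi] with i hi
        exact Eventually.of_forall fun u hu => (hi u (hintd z u hu)).2.2
      · exact Eventually.of_forall fun u _ => (hq u).mul (hy u)
    refine (ht.const_add a).congr' ?_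
    filter_upwards [hsol] with i hi
    have hc : Continuous (y i) := continuous_iff_continuousAt.2 fun z => (hi.hasDerivAt z).continuousAt
    rw [intervalIntegral.integral_eq_sub_of_hasDerivAt (fun u _ => hi.hasDerivAt' u)
      (((hqc i).mul hc).intervalIntegrable _ _), hi.zero']
    ring
  have hyint : ∀ z, y₀ z = ∫ u in (0 : ℝ)..z, p u := by
    intro z
    obtain ⟨B, hB0, hBi⟩ := hB |z| (abs_nonneg z)
    have ht : Tendsto (fun i => ∫ u in (0 : ℝ)..z, y' i u) l (𝓝 (∫ u in (0 : ℝ)..z, p u)) := by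
      refine intervalIntegral.tendsto_integral_filter_of_dominated_convergence (fun _ => B) ?_ ?_
        intervalIntegrable_const ?_
      · filter_upwards [hsol] with i hi
        have : Continuous (y' i) :=
          continuous_iff_continuousAt.2 fun z => (hi.hasDerivAt' z).continuousAt
        exact this.aestronglyMeasurable
      · filter_upwards [hBi] with i hi
        exact Eventually.of_forall fun u hu => (hi u (hintd z u hu)).2.1
      · exact Eventually.of_forall fun u _ => hlim' u
    refine tendsto_nhds_unique (hy z) (ht.congr' ?_)
    filter_upwards [hsol] with i hi
    have hc : Continuous (y' i) := continuous_iff_continuousAt.2 fun z => (hi.hasDerivAt' z).continuousAt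
    rw [intervalIntegral.integral_eq_sub_of_hasDerivAt (fun u _ => hi.hasDerivAt u)
      (hc.intervalIntegrable _ _), hi.zero, sub_zero]
  refine ⟨p, fun z => ?_, hpd, by simpa using hyint 0, by simp [hp]⟩
  rw [funext hyint]
  exact (hpc.integral_hasStrictDerivAt 0 z).hasDerivAt

theorem crossU_isIVPSol {b ν ρ : ℝ} (hb : 0 < b) (hρ : 0 < ρ) (hν : 0 ≤ ν) :
    ∃ y', IsIVPSol (fun z => ν ^ 2 - (ρ * b * Real.exp (-z)) ^ 2) (2 / Real.pi)
      (fun z => crossU b ν ρ (b * Real.exp (-z))) y' := by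
  by_cases h : ∃ n : ℤ, (n : ℝ) = ν
  · obtain ⟨k, rfl⟩ := h
    obtain ⟨n, rfl⟩ := Int.eq_ofNat_of_zero_le (by exact_mod_cast hν : 0 ≤ k)
    push_cast
    refine exists_isIVPSol_of_tendsto (l := 𝓝[≠] (n : ℝ))
      (q := fun μ z => μ ^ 2 - (ρ * b * Real.exp (-z)) ^ 2)
      (y := fun μ z => crossU b μ ρ (b * Real.exp (-z))) (y' := fun μ => crossUExpDeriv b μ ρ)
      ?_ (by fun_prop) (fun i => by fun_prop) ?_ ?_
      fun z => tendsto_crossU n hb hρ (by positivity)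
    · filter_upwards [eventually_not_int n] with μ hμ
      exact crossU_isIVPSol_of_not_int hb hρ hμ
    · intro z
      have : Continuous fun μ : ℝ => μ ^ 2 - (ρ * b * Real.exp (-z)) ^ 2 := by fun_prop
      exact (this.tendsto _).mono_left nhdsWithin_le_nhds
    · intro M
      refine ⟨(n + 1) ^ 2 + (ρ * b * Real.exp M) ^ 2, ?_⟩
      refine eventually_nhdsWithin_of_eventually_nhds ?_
      filter_upwards [Metric.ball_mem_nhds (n : ℝ) one_pos] with μ hμ z hz
      rw [Metric.mem_ball, Real.dist_eq] at hμ
      have h1 : |μ| ≤ n + 1 := by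
        have := abs_sub_abs_le_abs_sub μ n
        rw [Nat.abs_cast] at this
        linarith
      have h2 : Real.exp (-z) ≤ Real.exp M := Real.exp_le_exp.2 (by linarith [neg_le_abs z])
      calc |μ ^ 2 - (ρ * b * Real.exp (-z)) ^ 2| ≤ |μ ^ 2| + |(ρ * b * Real.exp (-z)) ^ 2| :=
            abs_sub _ _
        _ = |μ| ^ 2 + (ρ * b * Real.exp (-z)) ^ 2 := by
            rw [abs_pow, abs_of_nonneg (sq_nonneg (ρ * b * Real.exp (-z)))]
        _ ≤ _ := by gcongr
  · exact ⟨_, crossU_isIVPSol_of_not_int hb hρ h⟩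

/-! ### The compact operator attached to a continuous family of vectors -/

section KernelOperator

variable {V : Type*} [NormedAddCommGroup V] [InnerProductSpace ℝ V]

/-- The integral operator `∫_0^L w(x) e(x) ⊗ e(x) dx`. -/
noncomputable def kernelOp (L : ℝ) (w : ℝ → ℝ) (e : ℝ → V) : V →L[ℝ] V :=
  ∫ x in (0 : ℝ)..L, w x • InnerProductSpace.rankOne ℝ (e x) (e x)

variable {L : ℝ} {w : ℝ → ℝ} {e : ℝ → V}

theorem continuous_kernelOp_integrand (hw : Continuous w) (he : Continuous e) :
    Continuous fun x => w x • InnerProductSpace.rankOne ℝ (e x) (e x) :=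
  hw.smul (((InnerProductSpace.rankOne ℝ).continuous.comp he).clm_apply he)

theorem kernelOp_apply (hw : Continuous w) (he : Continuous e) (f : V) :
    kernelOp L w e f = ∫ x in (0 : ℝ)..L, (w x * ⟪e x, f⟫) • e x := by
  rw [kernelOp, ContinuousLinearMap.intervalIntegral_apply
    ((continuous_kernelOp_integrand hw he).intervalIntegrable _ _)]
  refine intervalIntegral.integral_congr fun x _ => ?_
  simp [smul_smul]

variable [CompleteSpace V]

theorem inner_intervalIntegral_smul {h : ℝ → ℝ} (hh : Continuous h) (he : Continuous e) (f : V) :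
    ⟪f, ∫ x in (0 : ℝ)..L, h x • e x⟫ = ∫ x in (0 : ℝ)..L, h x * ⟪f, e x⟫ := by
  have := (innerSL ℝ f).intervalIntegral_comp_comm (μ := MeasureTheory.volume)
    ((hh.smul he).intervalIntegrable 0 L)
  simp only [Pi.smul_apply', innerSL_apply_apply, inner_smul_right] at this
  exact this.symm

theorem inner_kernelOp (hw : Continuous w) (he : Continuous e) (f g : V) :
    ⟪g, kernelOp L w e f⟫ = ∫ x in (0 : ℝ)..L, w x * ⟪e x, f⟫ * ⟪g, e x⟫ := by
  rw [kernelOp_apply hw he, inner_intervalIntegral_smul (by fun_prop) he]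

theorem isSymmetric_kernelOp (hw : Continuous w) (he : Continuous e) :
    (kernelOp L w e).IsSymmetric := by
  intro f g
  change ⟪kernelOp L w e f, g⟫ = ⟪f, kernelOp L w e g⟫
  rw [real_inner_comm, inner_kernelOp hw he, inner_kernelOp hw he]
  refine intervalIntegral.integral_congr fun x _ => ?_
  simp only [real_inner_comm]
  ring

/-- The integrand has rank at most one, so it takes values in the closed, hence complete, subspace
of compact operators, and the integral can be formed inside it. -/
theorem isCompactOperator_kernelOp (hw : Continuous w) (he : Continuous e) :
    IsCompactOperator (kernelOp L w e) := by
  set K := compactOperator (RingHom.id ℝ) V V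
  have hK : IsClosed (K : Set (V →L[ℝ] V)) := isClosed_setOfPred_isCompactOperator
  have : CompleteSpace K := hK.completeSpace_coe
  have hmem : ∀ x, w x • InnerProductSpace.rankOne ℝ (e x) (e x) ∈ K := by
    intro x
    refine K.smul_mem _ ?_
    change IsCompactOperator (InnerProductSpace.rankOne ℝ (e x) (e x))
    rw [InnerProductSpace.rankOne_def']
    exact (isCompactOperator_of_locallyCompactSpace_dom (innerSL ℝ (e x))).clm_comp
      (ContinuousLinearMap.toSpanSingleton ℝ (e x))
  have hc : Continuous fun x => (⟨_, hmem x⟩ : K) :=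
    (continuous_kernelOp_integrand hw he).subtype_mk hmem
  have := ContinuousLinearMap.intervalIntegral_comp_comm (𝕜 := ℝ) (E := K)
    (μ := MeasureTheory.volume) K.subtypeL (hc.intervalIntegrable 0 L)
  have h2 : kernelOp L w e = K.subtypeL (∫ x in (0 : ℝ)..L, (⟨_, hmem x⟩ : K)) := this
  rw [h2]
  exact (∫ x in (0 : ℝ)..L, (⟨_, hmem x⟩ : K)).2

/-- Pairing with `f` gives `∫ w ⟪e, f⟫² = 0`, with a continuous nonnegative integrand. -/
theorem inner_eq_zero_of_kernelOp_eq_zero (hw : Continuous w) (hpos : ∀ x, 0 < w x)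
    (he : Continuous e) (hL : 0 < L) {f : V} (hf : kernelOp L w e f = 0) {x : ℝ}
    (hx : x ∈ Set.Icc 0 L) : ⟪e x, f⟫ = 0 := by
  by_contra hne
  have h := inner_kernelOp (L := L) hw he f f
  rw [hf, inner_zero_right] at h
  have : 0 < ∫ x in (0 : ℝ)..L, w x * ⟪e x, f⟫ * ⟪f, e x⟫ := by
    have hnn : ∀ x, w x * ⟪e x, f⟫ * ⟪f, e x⟫ = w x * ⟪e x, f⟫ ^ 2 := fun x => by
      rw [real_inner_comm (e x) f]; ring
    simp only [hnn]
    refine intervalIntegral.integral_pos hL (by fun_prop) (fun y _ => ?_) ⟨x, hx, ?_⟩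
    · have := hpos y; positivity
    · have := hpos x; positivity
  exact this.ne h

/-- If `f ⟂ W`, symmetry makes `kernelOp L w e f` orthogonal to every eigenspace, hence zero by the
spectral theorem. Then `f ⟂ e s`, so `e s` lies in the double orthogonal complement of `W`. -/
theorem mem_closure_of_eigenvectors (hw : Continuous w) (hpos : ∀ x, 0 < w x)
    (he : Continuous e) (hL : 0 < L) (W : Submodule ℝ V)
    (hW : ∀ μ : ℝ, μ ≠ 0 → ∀ f, kernelOp L w e f = μ • f → f ∈ W) {s : ℝ}
    (hs : s ∈ Set.Icc 0 L) : e s ∈ W.topologicalClosure := by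
  rw [← W.orthogonal_orthogonal_eq_closure, Submodule.mem_orthogonal']
  intro f hf
  refine inner_eq_zero_of_kernelOp_eq_zero hw hpos he hL ?_ hs
  have hsym := isSymmetric_kernelOp (L := L) hw he
  have hbot := ContinuousLinearMap.orthogonalComplement_iSup_eigenspaces_eq_bot
    (isCompactOperator_kernelOp (L := L) hw he) hsym
  rw [← Submodule.mem_bot ℝ, ← hbot, Submodule.mem_orthogonal]
  intro g hg
  have hle : (⨆ μ, Module.End.eigenspace (kernelOp L w e : Module.End ℝ V) μ) ≤
      (Submodule.span ℝ {kernelOp L w e f})ᗮ := by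
    refine iSup_le fun μ g hg => ?_
    rw [Module.End.mem_eigenspace_iff] at hg
    have hg : kernelOp L w e g = μ • g := hg
    rw [Submodule.mem_orthogonal_singleton_iff_inner_left]
    have h1 : ⟪g, kernelOp L w e f⟫ = ⟪kernelOp L w e g, f⟫ := (hsym g f).symm
    rw [h1, hg, inner_smul_left]
    rcases eq_or_ne μ 0 with rfl | hμ
    · simp
    · rw [(Submodule.mem_orthogonal W f).1 hf g (hW μ hμ g hg), mul_zero]
  exact (Submodule.mem_orthogonal_singleton_iff_inner_left).1 (hle hg)

end KernelOperator

/-- Expansion of a vector in the closed span of an orthogonal sequence. -/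
theorem tendsto_sum_orthogonal {V : Type*} [NormedAddCommGroup V] [InnerProductSpace ℝ V]
    [CompleteSpace V] {v : ℕ → V} (hv : ∀ m n, m ≠ n → ⟪v m, v n⟫ = 0) {x : V}
    (hx : x ∈ (Submodule.span ℝ (Set.range v)).topologicalClosure) :
    Tendsto (fun M => ∑ m ∈ Finset.range M, (⟪v m, x⟫ / ⟪v m, v m⟫) • v m) atTop (𝓝 x) := by
  set U : ℕ → Submodule ℝ V := fun M => Submodule.span ℝ (v '' (Finset.range M : Set ℕ)) with hU
  have : ∀ M, FiniteDimensional ℝ (U M) := fun M =>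
    FiniteDimensional.span_of_finite ℝ ((Finset.finite_toSet _).image v)
  have hmono : Monotone U := fun M N h => Submodule.span_mono (Set.image_mono (by
    intro i; simp only [Finset.coe_range, Set.mem_Iio]; omega))
  have hsup : ⨆ M, U M = Submodule.span ℝ (Set.range v) := by
    rw [hU, ← Submodule.span_iUnion, ← Set.image_iUnion]
    congr 1
    rw [← Set.image_univ]
    congr 1
    refine Set.eq_univ_of_forall fun m => Set.mem_iUnion.2 ⟨m + 1, by simp⟩
  have key := Submodule.starProjection_tendsto_closure_iSup U hmono x
  have hp : (⨆ i, U i).topologicalClosure.starProjection x = x := by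
    rw [Submodule.starProjection_eq_self_iff, hsup]
    exact hx
  rw [hp] at key
  refine key.congr fun M => ?_
  refine Submodule.eq_starProjection_of_mem_of_inner_eq_zero (K := U M) ?_ ?_
  · exact Submodule.sum_mem _ fun m hm => Submodule.smul_mem _ _
      (Submodule.subset_span ⟨m, hm, rfl⟩)
  · intro f hf
    induction hf using Submodule.span_induction with
    | zero => simp
    | add f g _ _ hf hg => rw [inner_add_right, hf, hg, add_zero]
    | smul c f _ hf => rw [inner_smul_right, hf, mul_zero]
    | mem f hf =>
      obtain ⟨n, hn, rfl⟩ := hf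
      rw [inner_sub_left, sum_inner, Finset.sum_eq_single n]
      · rw [inner_smul_left, real_inner_comm]
        -- Zero vectors are allowed in the sequence: their coefficient is `0 / 0 = 0`.
        rcases eq_or_ne (v n) 0 with h0 | h0
        · simp [h0]
        · have : ⟪v n, v n⟫ ≠ 0 := inner_self_ne_zero.2 h0
          simp only [conj_trivial]
          field_simp
          ring
      · intro m _ hmn
        rw [inner_smul_left, hv m n hmn, mul_zero]
      · intro h; exact absurd hn h

/-! ### The Green function as a Gram matrix -/

/-- A fundamental pair for `y'' = κ y` on `[0, L]` adapted to Dirichlet conditions. -/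
structure IsDirichletPair (κ L : ℝ) (u v u' v' : ℝ → ℝ) : Prop where
  left : IsIVPSol (fun _ => κ) (u' 0) u u'
  hasDerivAt_right : ∀ z, HasDerivAt v (v' z) z
  hasDerivAt_right' : ∀ z, HasDerivAt v' (κ * v z) z
  right_eq : v L = 0
  wronskian : ∀ z, u' z * v z - u z * v' z = 1
  mono : MonotoneOn u (Set.Icc 0 L)
  anti : AntitoneOn v (Set.Icc 0 L)
  pos : ∀ z ∈ Set.Ico 0 L, 0 < v z

/-- With `τ = u / v`, which is nondecreasing on `[0, L)`, the kernel `u(x) v(z)` for `x ≤ z` equals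
`v(x) v(z) min(τ x, τ z)`, and the minimum is the `L²` inner product of the indicators of `(0, τ x]`
and `(0, τ z]`. -/
theorem IsDirichletPair.exists_feature {κ L : ℝ} {u v u' v' : ℝ → ℝ}
    (h : IsDirichletPair κ L u v u' v') (hL : 0 < L) :
    ∃ e : ℝ → MeasureTheory.Lp ℝ 2 (MeasureTheory.volume : MeasureTheory.Measure ℝ),
      Continuous e ∧ ∀ x ∈ Set.Icc 0 L, ∀ z ∈ Set.Icc 0 L, x ≤ z → ⟪e x, e z⟫ = u x * v z := by
  set e₀ : ℝ → MeasureTheory.Lp ℝ 2 (MeasureTheory.volume : MeasureTheory.Measure ℝ) := fun x =>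
    v x • MeasureTheory.indicatorConstLp 2 (measurableSet_Ioc (a := 0) (b := u x / v x))
      measure_Ioc_lt_top.ne (1 : ℝ) with he₀
  have hu0 : ∀ x ∈ Set.Icc 0 L, 0 ≤ u x := fun x hx => by
    have := h.mono ⟨le_rfl, hL.le⟩ hx hx.1
    rwa [h.left.zero] at this
  have gram : ∀ x ∈ Set.Icc 0 L, ∀ z ∈ Set.Icc 0 L, x ≤ z → ⟪e₀ x, e₀ z⟫ = u x * v z := by
    intro x hx z hz hxz
    rw [he₀, inner_smul_left, inner_smul_right,
      MeasureTheory.L2.real_inner_indicatorConstLp_one_indicatorConstLp_one measurableSet_Ioc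
        measurableSet_Ioc measure_Ioc_lt_top.ne measure_Ioc_lt_top.ne]
    -- At `z = L` the quotient `u / v` divides by zero, but the prefactor `v L = 0` kills the
    -- vector.
    rcases eq_or_lt_of_le hz.2 with rfl | hzL
    · simp [h.right_eq]
    have hvz := h.pos z ⟨hz.1, hzL⟩
    have hvx := h.pos x ⟨hx.1, hxz.trans_lt hzL⟩
    have hτ : u x / v x ≤ u z / v z :=
      div_le_div₀ (hu0 z hz) (h.mono hx hz hxz) hvz (h.anti hx hz hxz)
    rw [Set.Ioc_inter_Ioc, max_self, min_eq_left hτ, Real.volume_real_Ioc_of_le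
      (div_nonneg (hu0 x hx) hvx.le)]
    simp only [conj_trivial]
    field_simp
    ring
  -- Clamping to `[0, L]` makes the family continuous on the whole line.
  set c : ℝ → ℝ := fun x => max 0 (min x L) with hc
  have hcm : ∀ x, c x ∈ Set.Icc 0 L := fun x => ⟨le_max_left _ _, max_le hL.le (min_le_right _ _)⟩
  have hcc : Continuous c := by fun_prop
  have hce : ∀ x ∈ Set.Icc 0 L, c x = x := fun x hx => by
    simp [hc, min_eq_left hx.2, max_eq_right hx.1]
  have gram' : ∀ x z, ⟪e₀ (c x), e₀ (c z)⟫ = u (min (c x) (c z)) * v (max (c x) (c z)) := by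
    intro x z
    rcases le_total (c x) (c z) with hxz | hxz
    · rw [gram _ (hcm x) _ (hcm z) hxz, min_eq_left hxz, max_eq_right hxz]
    · rw [real_inner_comm, gram _ (hcm z) _ (hcm x) hxz, min_eq_right hxz, max_eq_left hxz]
  have huc : Continuous u := continuous_iff_continuousAt.2 fun z => (h.left.hasDerivAt z).continuousAt
  have hvc : Continuous v := continuous_iff_continuousAt.2 fun z => (h.hasDerivAt_right z).continuousAt
  refine ⟨fun x => e₀ (c x), ?_, fun x hx z hz hxz => ?_⟩
  · rw [continuous_iff_continuousAt]
    intro x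
    rw [ContinuousAt, tendsto_iff_norm_sub_tendsto_zero]
    -- Expressing the distance through Gram entries gives continuity even at `L`, where `u / v` need
    -- not be continuous.
    have hsq : ∀ z, ‖e₀ (c z) - e₀ (c x)‖ = Real.sqrt (u (c z) * v (c z) -
        2 * (u (min (c z) (c x)) * v (max (c z) (c x))) + u (c x) * v (c x)) := by
      intro z
      rw [← gram' z x, ← gram _ (hcm z) _ (hcm z) le_rfl, ← gram _ (hcm x) _ (hcm x) le_rfl,
        real_inner_self_eq_norm_sq, real_inner_self_eq_norm_sq, ← norm_sub_sq_real,
        Real.sqrt_sq (norm_nonneg _)]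
    simp only [hsq]
    have hcont : Continuous fun z => Real.sqrt (u (c z) * v (c z) -
        2 * (u (min (c z) (c x)) * v (max (c z) (c x))) + u (c x) * v (c x)) := by fun_prop
    have := hcont.tendsto x
    convert this using 2
    simp only [min_self, max_self]
    ring_nf
    simp
  · simp only [hce x hx, hce z hz]
    exact gram x hx z hz hxz

/-! ### Eigenfunctions, eigenvalues and the expansion of the Green function -/

section SturmLiouville

variable {V : Type*} [NormedAddCommGroup V] [InnerProductSpace ℝ V]

/-- `e` is a continuous family of vectors whose Gram matrix is the Green function `u(min) v(max)`
of `-y'' + κ y` on `[0, L]` with Dirichlet conditions. -/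
structure IsGreenFeature (κ L : ℝ) (u v u' v' : ℝ → ℝ) (e : ℝ → V) : Prop
    extends IsDirichletPair κ L u v u' v' where
  length_pos : 0 < L
  continuous : Continuous e
  gram : ∀ x ∈ Set.Icc 0 L, ∀ z ∈ Set.Icc 0 L, x ≤ z → ⟪e x, e z⟫ = u x * v z

/-- `Y ρ` solves `y'' = (κ - ρ² w) y`, `y(0) = 0`, `y'(0) = a ≠ 0`, for every `ρ > 0`. -/
structure IsSturmFamily (κ a : ℝ) (w : ℝ → ℝ) (Y : ℝ → ℝ → ℝ) : Prop where
  continuous : Continuous w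
  pos : ∀ x, 0 < w x
  ne_zero : a ≠ 0
  sol : ∀ ρ, 0 < ρ → ∃ y', IsIVPSol (fun z => κ - ρ ^ 2 * w z) a (Y ρ) y'

/-- The positive `ρ` for which `Y ρ` vanishes at `L`. -/
def sturmZeros (L : ℝ) (Y : ℝ → ℝ → ℝ) : Set ℝ := {ρ | 0 < ρ ∧ Y ρ L = 0}

variable {κ L a : ℝ} {w u v u' v' : ℝ → ℝ} {Y : ℝ → ℝ → ℝ} {e : ℝ → V}

theorem IsSturmFamily.continuous_sol (hY : IsSturmFamily κ a w Y) {ρ : ℝ} (hρ : 0 < ρ) :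
    Continuous (Y ρ) := by
  obtain ⟨y', h⟩ := hY.sol ρ hρ
  exact continuous_iff_continuousAt.2 fun z => (h.hasDerivAt z).continuousAt

theorem IsDirichletPair.continuous_left (h : IsDirichletPair κ L u v u' v') : Continuous u :=
  continuous_iff_continuousAt.2 fun z => (h.left.hasDerivAt z).continuousAt

theorem IsDirichletPair.continuous_right (h : IsDirichletPair κ L u v u' v') : Continuous v :=
  continuous_iff_continuousAt.2 fun z => (h.hasDerivAt_right z).continuousAt

theorem IsGreenFeature.integral_eq (h : IsGreenFeature κ L u v u' v' e) {g : ℝ → ℝ}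
    (hg : Continuous g) {x : ℝ} (hx : x ∈ Set.Icc 0 L) :
    ∫ z in (0 : ℝ)..L, g z * ⟪e x, e z⟫ =
      v x * (∫ z in (0 : ℝ)..x, g z * u z) + u x * ∫ z in x..L, g z * v z := by
  have he := h.continuous
  have hc : Continuous fun z => g z * ⟪e x, e z⟫ := by fun_prop
  rw [← intervalIntegral.integral_add_adjacent_intervals (hc.intervalIntegrable 0 x)
    (hc.intervalIntegrable x L), ← intervalIntegral.integral_const_mul,
    ← intervalIntegral.integral_const_mul]
  congr 1
  · refine intervalIntegral.integral_congr fun z hz => ?_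
    rw [Set.uIcc_of_le hx.1] at hz
    rw [real_inner_comm, h.gram z ⟨hz.1, hz.2.trans hx.2⟩ x hx hz.2]
    ring
  · refine intervalIntegral.integral_congr fun z hz => ?_
    rw [Set.uIcc_of_le hx.2] at hz
    rw [h.gram x hx z ⟨hx.1.trans hz.1, hz.2⟩ hz.1]
    ring

/-- Green's identity: `u' y - u y'` and `v' y - v y'` are primitives of `c w y u` and `c w y v`. The
Dirichlet conditions remove the boundary terms at `0` and `L`, and the unit Wronskian leaves `y x`.
-/
theorem IsGreenFeature.integral_sol (h : IsGreenFeature κ L u v u' v' e) (hw : Continuous w)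
    {c : ℝ} {y y' : ℝ → ℝ} (hy : IsIVPSol (fun z => κ - c * w z) a y y') (hyL : y L = 0) {x : ℝ}
    (hx : x ∈ Set.Icc 0 L) : c * ∫ z in (0 : ℝ)..L, (w z * y z) * ⟪e x, e z⟫ = y x := by
  have hyc : Continuous y := continuous_iff_continuousAt.2 fun z => (hy.hasDerivAt z).continuousAt
  have huc := h.continuous_left
  have hvc := h.continuous_right
  rw [h.integral_eq (hw.fun_mul hyc) hx, mul_add, mul_left_comm, mul_left_comm c (u x),
    ← intervalIntegral.integral_const_mul c, ← intervalIntegral.integral_const_mul c]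
  have d1 : ∀ z, HasDerivAt (fun z => u' z * y z - u z * y' z) (c * (w z * y z * u z)) z := by
    intro z
    refine (((h.left.hasDerivAt' z).mul (hy.hasDerivAt z)).sub
      ((h.left.hasDerivAt z).mul (hy.hasDerivAt' z))).congr_deriv ?_
    ring
  have d2 : ∀ z, HasDerivAt (fun z => v' z * y z - v z * y' z) (c * (w z * y z * v z)) z := by
    intro z
    refine (((h.hasDerivAt_right' z).mul (hy.hasDerivAt z)).sub
      ((h.hasDerivAt_right z).mul (hy.hasDerivAt' z))).congr_deriv ?_
    ring
  rw [intervalIntegral.integral_eq_sub_of_hasDerivAt (fun z _ => d1 z)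
      ((by fun_prop : Continuous fun z => c * (w z * y z * u z)).intervalIntegrable _ _),
    intervalIntegral.integral_eq_sub_of_hasDerivAt (fun z _ => d2 z)
      ((by fun_prop : Continuous fun z => c * (w z * y z * v z)).intervalIntegrable _ _),
    hy.zero, h.left.zero, hyL, h.right_eq]
  linear_combination y x * h.wronskian x

/-- The eigenvector attached to a zero `ρ`. -/
noncomputable def sturmVec (L : ℝ) (w : ℝ → ℝ) (Y : ℝ → ℝ → ℝ) (e : ℝ → V) (ρ : ℝ) : V :=
  ∫ z in (0 : ℝ)..L, (w z * Y ρ z) • e z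

variable [CompleteSpace V]

theorem IsGreenFeature.inner_sturmVec (h : IsGreenFeature κ L u v u' v' e)
    (hY : IsSturmFamily κ a w Y) {ρ : ℝ} (hρ : ρ ∈ sturmZeros L Y) {x : ℝ}
    (hx : x ∈ Set.Icc 0 L) : ⟪e x, sturmVec L w Y e ρ⟫ = Y ρ x / ρ ^ 2 := by
  obtain ⟨y', hy⟩ := hY.sol ρ hρ.1
  rw [sturmVec, inner_intervalIntegral_smul (hY.continuous.fun_mul (hY.continuous_sol hρ.1)) h.continuous,
    eq_div_iff (pow_ne_zero 2 hρ.1.ne'), mul_comm]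
  exact h.integral_sol hY.continuous hy hρ.2 hx

theorem IsGreenFeature.inner_sturmVec_sturmVec (h : IsGreenFeature κ L u v u' v' e)
    (hY : IsSturmFamily κ a w Y) {ρ σ : ℝ} (hρ : ρ ∈ sturmZeros L Y) (hσ : 0 < σ) :
    ⟪sturmVec L w Y e ρ, sturmVec L w Y e σ⟫ = (∫ z in (0 : ℝ)..L, w z * Y σ z * Y ρ z) / ρ ^ 2 := by
  conv_lhs => rw [sturmVec.eq_def L w Y e σ]
  rw [inner_intervalIntegral_smul (hY.continuous.fun_mul (hY.continuous_sol hσ)) h.continuous,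
    ← intervalIntegral.integral_div]
  refine intervalIntegral.integral_congr fun z hz => ?_
  rw [Set.uIcc_of_le h.length_pos.le] at hz
  rw [real_inner_comm, h.inner_sturmVec hY hρ hz]
  ring

/-- Computed from either side, the inner product is the same weighted integral divided by `ρ²` and
by `σ²`, so that integral vanishes. -/
theorem IsGreenFeature.inner_sturmVec_eq_zero (h : IsGreenFeature κ L u v u' v' e)
    (hY : IsSturmFamily κ a w Y) {ρ σ : ℝ} (hρ : ρ ∈ sturmZeros L Y) (hσ : σ ∈ sturmZeros L Y)
    (hne : ρ ≠ σ) : ⟪sturmVec L w Y e ρ, sturmVec L w Y e σ⟫ = 0 := by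
  have h1 := h.inner_sturmVec_sturmVec hY hρ hσ.1
  have h2 := h.inner_sturmVec_sturmVec hY hσ hρ.1
  have h3 : (∫ z in (0 : ℝ)..L, w z * Y ρ z * Y σ z) = ∫ z in (0 : ℝ)..L, w z * Y σ z * Y ρ z :=
    intervalIntegral.integral_congr fun z _ => by ring
  rw [real_inner_comm, h1, h3] at h2
  have hρ2 : ρ ^ 2 ≠ 0 := pow_ne_zero 2 hρ.1.ne'
  have hσ2 : σ ^ 2 ≠ 0 := pow_ne_zero 2 hσ.1.ne'
  rw [div_eq_div_iff hρ2 hσ2] at h2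
  have h4 : ρ ^ 2 ≠ σ ^ 2 := fun hsq => hne ((sq_eq_sq₀ hρ.1.le hσ.1.le).1 hsq)
  have h5 : (∫ z in (0 : ℝ)..L, w z * Y σ z * Y ρ z) = 0 := by
    have : (∫ z in (0 : ℝ)..L, w z * Y σ z * Y ρ z) * (ρ ^ 2 - σ ^ 2) = 0 := by linarith
    exact (mul_eq_zero.1 this).resolve_right (sub_ne_zero.2 h4)
  rw [h1, h5, zero_div]

theorem IsSturmFamily.exists_ne_zero (hY : IsSturmFamily κ a w Y) (hL : 0 < L) {ρ : ℝ}
    (hρ : 0 < ρ) : ∃ x ∈ Set.Icc 0 L, Y ρ x ≠ 0 := by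
  by_contra! hcon
  obtain ⟨y', hy⟩ := hY.sol ρ hρ
  have h0 : HasDerivWithinAt (Y ρ) (y' 0) (Set.Icc 0 L) 0 := (hy.hasDerivAt 0).hasDerivWithinAt
  have h1 : HasDerivWithinAt (Y ρ) 0 (Set.Icc 0 L) 0 :=
    (hasDerivWithinAt_const (0 : ℝ) (Set.Icc 0 L) (0 : ℝ)).congr (fun x hx => hcon x hx)
      (hcon 0 ⟨le_rfl, hL.le⟩)
  have := (uniqueDiffOn_Icc hL 0 ⟨le_rfl, hL.le⟩).eq_deriv _ h0 h1
  exact hY.ne_zero (hy.zero'.symm.trans this)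

theorem IsSturmFamily.integral_pos (hY : IsSturmFamily κ a w Y) (hL : 0 < L) {ρ : ℝ}
    (hρ : 0 < ρ) : 0 < ∫ z in (0 : ℝ)..L, w z * Y ρ z * Y ρ z := by
  obtain ⟨x, hx, hne⟩ := hY.exists_ne_zero hL hρ
  have hw := hY.continuous
  have hc := hY.continuous_sol hρ
  refine intervalIntegral.integral_pos hL (by fun_prop) (fun y _ => ?_) ⟨x, hx, ?_⟩
  · rw [mul_assoc]
    exact mul_nonneg (hY.pos y).le (mul_self_nonneg _)
  · rw [mul_assoc]
    exact mul_pos (hY.pos x) (mul_self_pos.2 hne)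

/-- The function `x ↦ ⟪e x, f⟫` satisfies the Green integral equation with eigenvalue `μ > 0`, hence
the differential equation with `ρ = μ^{-1/2}` and Dirichlet conditions. Uniqueness for the initial
value problem makes it a multiple of `Y ρ`. -/
theorem IsGreenFeature.exists_eq_smul_sturmVec (h : IsGreenFeature κ L u v u' v' e)
    (hY : IsSturmFamily κ a w Y) {μ : ℝ} (hμ : μ ≠ 0) {f : V} (hf : kernelOp L w e f = μ • f)
    (hf0 : f ≠ 0) : ∃ ρ ∈ sturmZeros L Y, ∃ α : ℝ, f = α • sturmVec L w Y e ρ := by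
  have hw := hY.continuous
  have he := h.continuous
  have hL := h.length_pos
  have huc := h.continuous_left
  have hvc := h.continuous_right
  have hμpos : 0 < μ := by
    refine lt_of_le_of_ne ?_ hμ.symm
    have h1 := inner_kernelOp (L := L) hw he f f
    rw [hf, inner_smul_right] at h1
    have h2 : 0 ≤ ∫ x in (0 : ℝ)..L, w x * ⟪e x, f⟫ * ⟪f, e x⟫ := by
      refine intervalIntegral.integral_nonneg hL.le fun x _ => ?_
      rw [real_inner_comm (e x) f, mul_assoc]
      exact mul_nonneg (hY.pos x).le (mul_self_nonneg _)
    have h3 : 0 < ⟪f, f⟫ := real_inner_self_pos.2 hf0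
    rw [← h1] at h2
    exact nonneg_of_mul_nonneg_left h2 h3
  set φ : ℝ → ℝ := fun x => ⟪e x, f⟫ with hφ
  have hφc : Continuous φ := by fun_prop
  set P : ℝ → ℝ := fun x => ∫ z in (0 : ℝ)..x, w z * φ z * u z with hP
  set Q : ℝ → ℝ := fun x => ∫ z in (0 : ℝ)..x, w z * φ z * v z with hQ
  have hPd : ∀ x, HasDerivAt P (w x * φ x * u x) x := fun x =>
    ((by fun_prop : Continuous fun z => w z * φ z * u z).integral_hasStrictDerivAt 0 x).hasDerivAt
  have hQd : ∀ x, HasDerivAt Q (w x * φ x * v x) x := fun x =>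
    ((by fun_prop : Continuous fun z => w z * φ z * v z).integral_hasStrictDerivAt 0 x).hasDerivAt
  -- This extends `μ φ` smoothly off `[0, L]`, where the Gram formula says nothing, so two-sided
  -- derivatives exist at the endpoints.
  set Φ : ℝ → ℝ := fun x => v x * P x + u x * (Q L - Q x) with hΦ
  set Φ' : ℝ → ℝ := fun x => v' x * P x + u' x * (Q L - Q x) with hΦ'
  have hΦd : ∀ x, HasDerivAt Φ (Φ' x) x := by
    intro x
    refine (((h.hasDerivAt_right x).mul (hPd x)).add ((h.left.hasDerivAt x).mul
      ((hQd x).const_sub (Q L)))).congr_deriv ?_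
    simp only [hΦ']
    ring
  have hΦd' : ∀ x, HasDerivAt Φ' (κ * Φ x - w x * φ x) x := by
    intro x
    refine (((h.hasDerivAt_right' x).mul (hPd x)).add ((h.left.hasDerivAt' x).mul
      ((hQd x).const_sub (Q L)))).congr_deriv ?_
    simp only [hΦ]
    linear_combination (-(w x * φ x)) * h.wronskian x
  have hΦφ : ∀ x ∈ Set.Icc 0 L, μ * φ x = Φ x := by
    intro x hx
    have h1 : μ * φ x = ⟪e x, kernelOp L w e f⟫ := by rw [hf, inner_smul_right]
    rw [h1, kernelOp_apply hw he, inner_intervalIntegral_smul (by fun_prop) he,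
      h.integral_eq (g := fun z => w z * φ z) (by fun_prop) hx]
    simp only [hΦ]
    congr 2
    exact (intervalIntegral.integral_interval_sub_left
      ((by fun_prop : Continuous fun z => w z * φ z * v z).intervalIntegrable _ _)
      ((by fun_prop : Continuous fun z => w z * φ z * v z).intervalIntegrable _ _)).symm
  set ρ : ℝ := (Real.sqrt μ)⁻¹ with hρ
  have hρpos : 0 < ρ := inv_pos.2 (Real.sqrt_pos.2 hμpos)
  have hρ2 : ρ ^ 2 = μ⁻¹ := by rw [hρ, inv_pow, Real.sq_sqrt hμpos.le]
  obtain ⟨y', hy⟩ := hY.sol ρ hρpos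
  -- Chosen so that `Φ` and `α * Y ρ` have equal slopes at `0`.
  set α := Φ' 0 / a with hα
  have hΦY : ∀ x ∈ Set.Icc 0 L, Φ x = α * Y ρ x := by
    intro x hx
    have := eq_zero_of_hasDerivAt (q := fun z => κ - ρ ^ 2 * w z) (M := L)
      (y := fun x => Φ x - α * Y ρ x) (y' := fun x => Φ' x - α * y' x)
      (fun z _ => (hΦd z).sub ((hy.hasDerivAt z).const_mul α))
      (fun z hz => ((hΦd' z).sub ((hy.hasDerivAt' z).const_mul α)).congr_deriv (by
        rw [← hΦφ z hz, hρ2]; field_simp))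
      (by simp [hΦ, hP, h.left.zero, hy.zero]) (by
        rw [hy.zero', hα, div_mul_cancel₀ _ hY.ne_zero, sub_self]) (by fun_prop) hx
    linarith
  have hfeq : f = (μ⁻¹ * (μ⁻¹ * α)) • sturmVec L w Y e ρ := by
    have h1 : f = μ⁻¹ • kernelOp L w e f := by rw [hf, smul_smul, inv_mul_cancel₀ hμ, one_smul]
    have h2 : kernelOp L w e f = (μ⁻¹ * α) • sturmVec L w Y e ρ := by
      rw [kernelOp_apply hw he, sturmVec, ← intervalIntegral.integral_smul]
      refine intervalIntegral.integral_congr fun z hz => ?_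
      rw [Set.uIcc_of_le hL.le] at hz
      have h3 : φ z = μ⁻¹ * (α * Y ρ z) := by
        rw [← hΦY z hz, ← hΦφ z hz, inv_mul_cancel_left₀ hμ]
      rw [smul_smul]
      congr 1
      change w z * φ z = _
      rw [h3]
      ring
    rw [h2, smul_smul] at h1
    exact h1
  refine ⟨ρ, ⟨hρpos, ?_⟩, _, hfeq⟩
  have hα0 : α ≠ 0 := by
    intro h0
    rw [h0] at hfeq
    simp at hfeq
    exact hf0 hfeq
  have hLL : Φ L = 0 := by simp [hΦ, h.right_eq]
  rw [hΦY L ⟨hL.le, le_rfl⟩] at hLL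
  exact (mul_eq_zero.1 hLL).resolve_left hα0

theorem IsGreenFeature.mem_closure_span (h : IsGreenFeature κ L u v u' v' e)
    (hY : IsSturmFamily κ a w Y) {s : ℝ} (hs : s ∈ Set.Icc 0 L) :
    e s ∈ (Submodule.span ℝ (sturmVec L w Y e '' sturmZeros L Y)).topologicalClosure := by
  refine mem_closure_of_eigenvectors hY.continuous hY.pos h.continuous h.length_pos _ ?_ hs
  intro μ hμ f hf
  rcases eq_or_ne f 0 with rfl | hf0
  · exact Submodule.zero_mem _
  obtain ⟨ρ, hρ, α, rfl⟩ := h.exists_eq_smul_sturmVec hY hμ hf hf0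
  exact Submodule.smul_mem _ _ (Submodule.subset_span ⟨ρ, hρ, rfl⟩)

/-- Bessel's inequality for `e x` against the normalised eigenvectors, integrated over `x` with
weight `w`; each term integrates to `ρ⁻²`, and the right side is the trace of the operator. -/
theorem IsGreenFeature.sum_inv_sq_le (h : IsGreenFeature κ L u v u' v' e)
    (hY : IsSturmFamily κ a w Y) (T : Finset ℝ) (hT : ↑T ⊆ sturmZeros L Y) :
    ∑ ρ ∈ T, (ρ ^ 2)⁻¹ ≤ ∫ x in (0 : ℝ)..L, w x * ‖e x‖ ^ 2 := by
  have hw := hY.continuous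
  have he := h.continuous
  set N : ℝ → ℝ := fun ρ => ∫ z in (0 : ℝ)..L, w z * Y ρ z * Y ρ z with hN
  have hNpos : ∀ ρ ∈ T, 0 < N ρ := fun ρ hρ => hY.integral_pos h.length_pos (hT hρ).1
  have hself : ∀ ρ ∈ T, ⟪sturmVec L w Y e ρ, sturmVec L w Y e ρ⟫ = N ρ / ρ ^ 2 := fun ρ hρ =>
    h.inner_sturmVec_sturmVec hY (hT hρ) (hT hρ).1
  have hbessel : ∀ x ∈ Set.Icc 0 L, ∑ ρ ∈ T, Y ρ x ^ 2 / (ρ ^ 2 * N ρ) ≤ ‖e x‖ ^ 2 := by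
    intro x hx
    have hon : Orthonormal ℝ fun ρ : T => ‖sturmVec L w Y e ρ‖⁻¹ • sturmVec L w Y e ρ := by
      constructor
      · intro ρ
        have h1 := hself ρ ρ.2
        have h2 : 0 < N ρ / (ρ : ℝ) ^ 2 := div_pos (hNpos ρ ρ.2) (pow_pos (hT ρ.2).1 2)
        rw [← h1] at h2
        have h3 : sturmVec L w Y e ρ ≠ 0 := real_inner_self_pos.1 h2
        rw [norm_smul, norm_inv, norm_norm, inv_mul_cancel₀ (norm_ne_zero_iff.2 h3)]
      · intro ρ σ hne
        simp only [inner_smul_left, inner_smul_right]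
        rw [h.inner_sturmVec_eq_zero hY (hT ρ.2) (hT σ.2) (fun hh => hne (Subtype.ext hh))]
        simp
    have := hon.sum_inner_products_le (s := Finset.univ) (e x)
    refine le_trans (le_of_eq ?_) this
    rw [← Finset.sum_coe_sort T]
    refine Finset.sum_congr rfl fun ρ _ => ?_
    rw [inner_smul_left, real_inner_comm, h.inner_sturmVec hY (hT ρ.2) hx, Real.norm_eq_abs, sq_abs,
      mul_pow]
    simp only [conj_trivial]
    rw [inv_pow, ← real_inner_self_eq_norm_sq, hself ρ ρ.2]
    have h1 := hNpos ρ ρ.2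
    have h2 := (hT ρ.2).1
    field_simp
  have hYc : ∀ ρ ∈ T, Continuous (Y ρ) := fun ρ hρ => hY.continuous_sol (hT hρ).1
  have hint : ∀ ρ ∈ T, ∫ x in (0 : ℝ)..L, w x * (Y ρ x ^ 2 / (ρ ^ 2 * N ρ)) = (ρ ^ 2)⁻¹ := by
    intro ρ hρ
    have h1 := hNpos ρ hρ
    have h2 := (hT hρ).1
    have : ∀ x, w x * (Y ρ x ^ 2 / (ρ ^ 2 * N ρ)) = (w x * Y ρ x * Y ρ x) / (ρ ^ 2 * N ρ) :=
      fun x => by ring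
    simp only [this, intervalIntegral.integral_div]
    change N ρ / _ = _
    field_simp
  have hc : ∀ ρ ∈ T, Continuous fun x => w x * (Y ρ x ^ 2 / (ρ ^ 2 * N ρ)) := fun ρ hρ => by
    have := hYc ρ hρ
    fun_prop
  calc ∑ ρ ∈ T, (ρ ^ 2)⁻¹ = ∑ ρ ∈ T, ∫ x in (0 : ℝ)..L, w x * (Y ρ x ^ 2 / (ρ ^ 2 * N ρ)) :=
        (Finset.sum_congr rfl hint).symm
    _ = ∫ x in (0 : ℝ)..L, ∑ ρ ∈ T, w x * (Y ρ x ^ 2 / (ρ ^ 2 * N ρ)) :=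
        (intervalIntegral.integral_finsetSum fun ρ hρ => (hc ρ hρ).intervalIntegrable _ _).symm
    _ ≤ _ := by
        refine intervalIntegral.integral_mono_on h.length_pos.le
          ((continuous_finsetSum T hc).intervalIntegrable _ _)
          ((by fun_prop : Continuous fun x => w x * ‖e x‖ ^ 2).intervalIntegrable _ _) fun x hx => ?_
        rw [← Finset.mul_sum]
        exact mul_le_mul_of_nonneg_left (hbessel x hx) (hY.pos x).le

theorem IsGreenFeature.finite_sturmZeros_inter_Iic (h : IsGreenFeature κ L u v u' v' e)
    (hY : IsSturmFamily κ a w Y) (R : ℝ) : (sturmZeros L Y ∩ Set.Iic R).Finite := by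
  by_contra hinf
  set C := ∫ x in (0 : ℝ)..L, w x * ‖e x‖ ^ 2
  obtain ⟨n, hn⟩ := exists_nat_gt (C * R ^ 2)
  obtain ⟨T, hTs, hTc⟩ := Set.Infinite.exists_subset_card_eq hinf (n + 1)
  have h1 := h.sum_inv_sq_le hY T (hTs.trans Set.inter_subset_left)
  obtain ⟨ρ₀, hρ₀⟩ : T.Nonempty := Finset.card_pos.1 (by omega)
  have hR : 0 < R := (hTs hρ₀).1.1.trans_le (hTs hρ₀).2
  have h2 : (T.card : ℝ) * (R ^ 2)⁻¹ ≤ ∑ ρ ∈ T, (ρ ^ 2)⁻¹ := by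
    rw [← nsmul_eq_mul]
    refine Finset.card_nsmul_le_sum _ _ _ fun ρ hρ => ?_
    have hpos := (hTs hρ).1.1
    have hle : ρ ≤ R := (hTs hρ).2
    gcongr
  have h3 : (T.card : ℝ) * (R ^ 2)⁻¹ ≤ C := h2.trans h1
  rw [← div_eq_mul_inv, div_le_iff₀ (by positivity), hTc] at h3
  push_cast at h3
  linarith

/-- With finitely many zeros, `e s` would be a finite combination of eigenvectors, so `x ↦ ⟪e x, e
s⟫` would be differentiable at `s`. But the one-sided derivatives of the Green function there, `u'
v` and `u v'`, differ by the Wronskian 1. -/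
theorem IsGreenFeature.infinite_sturmZeros (h : IsGreenFeature κ L u v u' v' e)
    (hY : IsSturmFamily κ a w Y) : (sturmZeros L Y).Infinite := by
  intro hfin
  have hL := h.length_pos
  set s := L / 2 with hs
  have hs0 : 0 < s := by positivity
  have hsL : s < L := by linarith
  have hsI : s ∈ Set.Icc 0 L := ⟨hs0.le, hsL.le⟩
  have : FiniteDimensional ℝ (Submodule.span ℝ (sturmVec L w Y e '' sturmZeros L Y)) :=
    FiniteDimensional.span_of_finite ℝ (hfin.image _)
  have hmem := h.mem_closure_span hY hsI
  rw [(Submodule.closed_of_finiteDimensional _).submodule_topologicalClosure_eq] at hmem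
  have key : ∀ f ∈ Submodule.span ℝ (sturmVec L w Y e '' sturmZeros L Y),
      ∃ g : ℝ → ℝ, Differentiable ℝ g ∧ ∀ x ∈ Set.Icc 0 L, ⟪e x, f⟫ = g x := by
    intro f hf
    induction hf using Submodule.span_induction with
    | zero => exact ⟨fun _ => 0, differentiable_const _, by simp⟩
    | add f₁ f₂ _ _ h₁ h₂ =>
      obtain ⟨g₁, hd₁, hg₁⟩ := h₁
      obtain ⟨g₂, hd₂, hg₂⟩ := h₂
      exact ⟨fun x => g₁ x + g₂ x, hd₁.add hd₂, fun x hx => by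
        rw [inner_add_right, hg₁ x hx, hg₂ x hx]⟩
    | smul c f _ hf =>
      obtain ⟨g, hd, hg⟩ := hf
      exact ⟨fun x => c * g x, hd.const_mul c, fun x hx => by rw [inner_smul_right, hg x hx]⟩
    | mem f hf =>
      obtain ⟨ρ, hρ, rfl⟩ := hf
      obtain ⟨y', hy⟩ := hY.sol ρ hρ.1
      exact ⟨fun x => Y ρ x / ρ ^ 2, fun x => (hy.hasDerivAt x).differentiableAt.div_const _,
        fun x hx => h.inner_sturmVec hY hρ hx⟩
  obtain ⟨g, hd, hg⟩ := key _ hmem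
  have hgd := (hd s).hasDerivAt
  have hl : deriv g s = u' s * v s := by
    have h1 : HasDerivWithinAt g (u' s * v s) (Set.Icc 0 s) s := by
      refine (((h.left.hasDerivAt s).mul_const (v s)).hasDerivWithinAt).congr (fun x hx => ?_) ?_
      · rw [← hg x ⟨hx.1, hx.2.trans hsL.le⟩, h.gram x ⟨hx.1, hx.2.trans hsL.le⟩ s hsI hx.2]
      · rw [← hg s hsI, h.gram s hsI s hsI le_rfl]
    exact (uniqueDiffOn_Icc hs0 s ⟨hs0.le, le_rfl⟩).eq_deriv _ hgd.hasDerivWithinAt h1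
  have hr : deriv g s = u s * v' s := by
    have h1 : HasDerivWithinAt g (u s * v' s) (Set.Icc s L) s := by
      refine (((h.hasDerivAt_right s).const_mul (u s)).hasDerivWithinAt).congr (fun x hx => ?_) ?_
      · rw [← hg x ⟨hs0.le.trans hx.1, hx.2⟩, real_inner_comm,
          h.gram s hsI x ⟨hs0.le.trans hx.1, hx.2⟩ hx.1]
      · rw [← hg s hsI, h.gram s hsI s hsI le_rfl]
    exact (uniqueDiffOn_Icc hsL s ⟨le_rfl, hsL.le⟩).eq_deriv _ hgd.hasDerivWithinAt h1
  have := h.wronskian s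
  linarith

/-- Partial sums are `e t` paired with the partial expansions of `e s`. These converge in norm, so
Cauchy–Schwarz and the boundedness of `e` on `[0, L]` give uniformity in `t`. -/
theorem IsGreenFeature.tendstoUniformlyOn (h : IsGreenFeature κ L u v u' v' e)
    (hY : IsSturmFamily κ a w Y) {r : ℕ → ℝ} (hr : Function.Injective r)
    (hrange : Set.range r = sturmZeros L Y) {s : ℝ} (hs : s ∈ Set.Icc 0 L) :
    TendstoUniformlyOn (fun M t => ∑ m ∈ Finset.range M, Y (r m) s * Y (r m) t /
        (r m ^ 2 * ∫ z in (0 : ℝ)..L, w z * Y (r m) z * Y (r m) z))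
      (fun t => ⟪e t, e s⟫) atTop (Set.Icc 0 L) := by
  have hmem : ∀ m, r m ∈ sturmZeros L Y := fun m => hrange ▸ Set.mem_range_self m
  set f : ℕ → V := fun m => sturmVec L w Y e (r m) with hf
  have hrf : Set.range f = sturmVec L w Y e '' sturmZeros L Y := by
    rw [← hrange, ← Set.range_comp]; rfl
  have hlim := tendsto_sum_orthogonal (v := f) (x := e s)
    (fun m n hmn => h.inner_sturmVec_eq_zero hY (hmem m) (hmem n) (fun hh => hmn (hr hh)))
    (by rw [hrf]; exact h.mem_closure_span hY hs)
  obtain ⟨C, hC⟩ := isCompact_Icc.exists_bound_of_continuousOn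
    (f := e) (s := Set.Icc 0 L) h.continuous.continuousOn
  have hsum : ∀ M, ∀ t ∈ Set.Icc 0 L, ∑ m ∈ Finset.range M, Y (r m) s * Y (r m) t /
      (r m ^ 2 * ∫ z in (0 : ℝ)..L, w z * Y (r m) z * Y (r m) z) =
      ⟪e t, ∑ m ∈ Finset.range M, (⟪f m, e s⟫ / ⟪f m, f m⟫) • f m⟫ := by
    intro M t ht
    rw [inner_sum]
    refine Finset.sum_congr rfl fun m _ => ?_
    rw [inner_smul_right, h.inner_sturmVec hY (hmem m) ht, real_inner_comm,
      h.inner_sturmVec hY (hmem m) hs, h.inner_sturmVec_sturmVec hY (hmem m) (hmem m).1]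
    have h1 := (hmem m).1
    have h2 := hY.integral_pos h.length_pos (hmem m).1
    field_simp
  rw [Metric.tendstoUniformlyOn_iff]
  intro ε hε
  have hlim' := (Metric.tendsto_nhds.1 hlim) (ε / (|C| + 1)) (by positivity)
  filter_upwards [hlim'] with M hM t ht
  rw [hsum M t ht, dist_comm, Real.dist_eq, ← inner_sub_right]
  rw [dist_eq_norm, lt_div_iff₀ (by positivity)] at hM
  calc _ ≤ ‖e t‖ * _ := abs_real_inner_le_norm _ _
    _ ≤ (|C| + 1) * _ := by
        gcongr
        linarith [hC t ht, le_abs_self C]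
    _ < ε := by rwa [mul_comm]

end SturmLiouville

section

variable {κ L a : ℝ} {w u v u' v' : ℝ → ℝ} {Y : ℝ → ℝ → ℝ}

theorem sturmZeros_discrete (h : IsDirichletPair κ L u v u' v') (hL : 0 < L)
    (hY : IsSturmFamily κ a w Y) :
    (sturmZeros L Y).Infinite ∧ ∀ R, (sturmZeros L Y ∩ Set.Iic R).Finite := by
  obtain ⟨e, hec, heg⟩ := h.exists_feature hL
  have he : IsGreenFeature κ L u v u' v' e := ⟨h, hL, hec, heg⟩
  exact ⟨he.infinite_sturmZeros hY, he.finite_sturmZeros_inter_Iic hY⟩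

/-- The eigenfunction expansion of the Green function. -/
theorem tendstoUniformlyOn_green (h : IsDirichletPair κ L u v u' v') (hL : 0 < L)
    (hY : IsSturmFamily κ a w Y) {r : ℕ → ℝ} (hr : Function.Injective r)
    (hrange : Set.range r = sturmZeros L Y) {s : ℝ} (hs : s ∈ Set.Icc 0 L) :
    TendstoUniformlyOn (fun M t => ∑ m ∈ Finset.range M, Y (r m) s * Y (r m) t /
        (r m ^ 2 * ∫ z in (0 : ℝ)..L, w z * Y (r m) z * Y (r m) z))
      (fun t => if s ≤ t then u s * v t else u t * v s) atTop (Set.Icc 0 L) := by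
  obtain ⟨e, hec, heg⟩ := h.exists_feature hL
  have he : IsGreenFeature κ L u v u' v' e := ⟨h, hL, hec, heg⟩
  refine (he.tendstoUniformlyOn hY hr hrange hs).congr_right fun t ht => ?_
  simp only
  split_ifs with hst
  · rw [real_inner_comm, heg s hs t ht hst]
  · exact heg t ht s hs (not_le.1 hst).le

end

/-! ### Enumerating the zeros -/

/-- Recursive enumeration of a locally finite unbounded set of positive reals. -/
theorem strictMono_and_image_eq_of_sInf {Z : Set ℝ} (hpos : ∀ ρ ∈ Z, 0 < ρ) (hinf : Z.Infinite)
    (hfin : ∀ R, (Z ∩ Set.Iic R).Finite) {c : ℕ → ℝ} (h0 : c 0 = 0)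
    (hs : ∀ m, 0 ≤ c m → c (m + 1) = sInf {ρ | c m < ρ ∧ ρ ∈ Z}) :
    StrictMono c ∧ c '' Set.Ici 1 = Z := by
  have hleast : ∀ R, IsLeast {ρ | R < ρ ∧ ρ ∈ Z} (sInf {ρ | R < ρ ∧ ρ ∈ Z}) := by
    intro R
    obtain ⟨ρ₀, hρ₀Z, hρ₀⟩ : ∃ ρ ∈ Z, R < ρ := by
      by_contra! hcon
      exact hinf ((hfin R).subset fun ρ hρ => ⟨hρ, hcon ρ hρ⟩)
    have hf : {ρ | R < ρ ∧ ρ ∈ Z ∧ ρ ≤ ρ₀}.Finite :=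
      (hfin ρ₀).subset fun ρ hρ => ⟨hρ.2.1, hρ.2.2⟩
    obtain ⟨x, hx, hmin⟩ := Set.exists_min_image _ id hf ⟨ρ₀, hρ₀, hρ₀Z, le_rfl⟩
    have hl : IsLeast {ρ | R < ρ ∧ ρ ∈ Z} x := by
      refine ⟨⟨hx.1, hx.2.1⟩, fun ρ hρ => ?_⟩
      rcases le_total ρ ρ₀ with h | h
      · exact hmin ρ ⟨hρ.1, hρ.2, h⟩
      · exact hx.2.2.trans h
    rwa [hl.csInf_eq]
  have hnn : ∀ m, 0 ≤ c m := by
    intro m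
    induction m with
    | zero => exact h0.ge
    | succ m ih =>
      rw [hs m ih]
      exact (hpos _ (hleast (c m)).1.2).le
  have hl : ∀ m, IsLeast {ρ | c m < ρ ∧ ρ ∈ Z} (c (m + 1)) := fun m => by
    rw [hs m (hnn m)]
    exact hleast (c m)
  have hmono : StrictMono c := strictMono_nat_of_lt_succ fun m => (hl m).1.1
  refine ⟨hmono, Set.Subset.antisymm ?_ fun ρ hρ => ?_⟩
  · rintro _ ⟨m, hm, rfl⟩
    obtain ⟨k, rfl⟩ : ∃ k, m = k + 1 := ⟨m - 1, (Nat.sub_add_cancel hm).symm⟩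
    exact (hl k).1.2
  -- A zero missed by the enumeration would exceed every `c m`, leaving infinitely many elements of
  -- `Z` below it.
  · by_contra hcon
    have hlt : ∀ m, c m < ρ := by
      intro m
      induction m with
      | zero => exact h0 ▸ hpos ρ hρ
      | succ m ih =>
        refine lt_of_le_of_ne ((hl m).2 ⟨ih, hρ⟩) fun heq => hcon ⟨m + 1, ?_, heq⟩
        simp
    exact Set.infinite_of_injective_forall_mem (f := fun m => c (m + 1))
      (hmono.injective.comp (add_left_injective 1))
      (fun m => (⟨(hl m).1.2, (hlt (m + 1)).le⟩ : c (m + 1) ∈ Z ∩ Set.Iic ρ)) (hfin ρ)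

/-! ### Explicit Green functions and the return to the variable `t` -/

theorem isDirichletPair_sinh {ν L : ℝ} (hν : 0 < ν) (hL : 0 < L) :
    IsDirichletPair (ν ^ 2) L (fun z => Real.sinh (ν * z) / (ν * Real.sinh (ν * L)))
      (fun z => Real.sinh (ν * (L - z))) (fun z => Real.cosh (ν * z) / Real.sinh (ν * L))
      (fun z => -ν * Real.cosh (ν * (L - z))) := by
  have hS : 0 < Real.sinh (ν * L) := Real.sinh_pos_iff.2 (by positivity)
  have d1 : ∀ z : ℝ, HasDerivAt (fun z => ν * z) ν z := fun z => by
    simpa using (hasDerivAt_id z).const_mul ν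
  have d2 : ∀ z : ℝ, HasDerivAt (fun z => ν * (L - z)) (-ν) z := fun z => by
    simpa using ((hasDerivAt_id z).const_sub L).const_mul ν
  refine ⟨⟨fun z => ?_, fun z => ?_, by simp, rfl⟩, fun z => ?_, fun z => ?_, by simp, fun z => ?_,
    fun x _ y _ hxy => ?_, fun x _ y _ hxy => ?_, fun z hz => ?_⟩
  · refine ((d1 z).sinh.div_const _).congr_deriv ?_
    field_simp
  · refine ((d1 z).cosh.div_const _).congr_deriv ?_
    field_simp
  · refine (d2 z).sinh.congr_deriv ?_
    ring
  · refine ((d2 z).cosh.const_mul _).congr_deriv ?_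
    ring
  · have h1 : Real.sinh (ν * L) = Real.sinh (ν * z) * Real.cosh (ν * (L - z)) +
        Real.cosh (ν * z) * Real.sinh (ν * (L - z)) := by
      rw [← Real.sinh_add]; congr 1; ring
    field_simp
    linarith
  · have : Real.sinh (ν * x) ≤ Real.sinh (ν * y) := Real.sinh_le_sinh.2 (by gcongr)
    gcongr
  · exact Real.sinh_le_sinh.2 (by gcongr)
  · exact Real.sinh_pos_iff.2 (mul_pos hν (sub_pos.2 hz.2))

theorem isDirichletPair_linear {L : ℝ} (hL : 0 < L) :
    IsDirichletPair (0 ^ 2) L (fun z => z / L) (fun z => L - z) (fun _ => 1 / L) (fun _ => -1) := by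
  refine ⟨⟨fun z => ?_, fun z => ?_, by simp, rfl⟩, fun z => ?_, fun z => ?_, by simp, fun z => ?_,
    fun x _ y _ hxy => ?_, fun x _ y _ hxy => ?_, fun z hz => ?_⟩
  · exact (hasDerivAt_id z).div_const L
  · simpa using hasDerivAt_const z (1 / L)
  · simpa using (hasDerivAt_id z).const_sub L
  · simpa using hasDerivAt_const z (-1 : ℝ)
  · field_simp
    ring
  · gcongr
  · linarith
  · exact sub_pos.2 hz.2

theorem exists_isDirichletPair {ν L : ℝ} (hν : 0 ≤ ν) (hL : 0 < L) :
    ∃ u v u' v' : ℝ → ℝ, IsDirichletPair (ν ^ 2) L u v u' v' := by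
  rcases hν.eq_or_lt with rfl | hν
  · exact ⟨_, _, _, _, isDirichletPair_linear hL⟩
  · exact ⟨_, _, _, _, isDirichletPair_sinh hν hL⟩

theorem isSturmFamily_crossU {b ν : ℝ} (hb : 0 < b) (hν : 0 ≤ ν) :
    IsSturmFamily (ν ^ 2) (2 / Real.pi) (fun z => (b * Real.exp (-z)) ^ 2)
      (fun ρ z => crossU b ν ρ (b * Real.exp (-z))) := by
  refine ⟨by fun_prop, fun x => by positivity, by positivity, fun ρ hρ => ?_⟩
  obtain ⟨y', hy⟩ := crossU_isIVPSol hb hρ hν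
  refine ⟨y', ?_⟩
  have : (fun z => ν ^ 2 - ρ ^ 2 * (b * Real.exp (-z)) ^ 2) =
      fun z => ν ^ 2 - (ρ * b * Real.exp (-z)) ^ 2 := by
    funext z; ring
  rwa [this]

theorem mul_exp_neg_log_div {b t : ℝ} (hb : 0 < b) (ht : 0 < t) :
    b * Real.exp (-Real.log (b / t)) = t := by
  rw [← Real.log_inv, Real.exp_log (by positivity)]
  field_simp

theorem sturmZeros_crossU {b : ℝ} (hb : 0 < b) (ν : ℝ) :
    sturmZeros (Real.log b) (fun ρ z => crossU b ν ρ (b * Real.exp (-z))) =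
      {ρ : ℝ | 0 < ρ ∧ crossU b ν ρ 1 = 0} := by
  have := mul_exp_neg_log_div hb one_pos
  rw [div_one] at this
  simp only [sturmZeros, this]

theorem crossZero_enumerates {b ν : ℝ} (hb : 1 < b) (hν : 0 ≤ ν) :
    StrictMono (crossZero b ν) ∧
      crossZero b ν '' Set.Ici 1 = {ρ : ℝ | 0 < ρ ∧ crossU b ν ρ 1 = 0} := by
  have hb0 : 0 < b := by linarith
  have hL := Real.log_pos hb
  obtain ⟨u, v, u', v', hp⟩ := exists_isDirichletPair hν hL
  obtain ⟨hinf, hfin⟩ := sturmZeros_discrete hp hL (isSturmFamily_crossU hb0 hν)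
  rw [sturmZeros_crossU hb0] at hinf
  simp only [sturmZeros_crossU hb0] at hfin
  refine strictMono_and_image_eq_of_sInf (fun ρ hρ => hρ.1) hinf hfin rfl fun m hm => ?_
  rw [crossZero]
  congr 1
  ext ρ
  -- The recursion does not require positivity; it comes from `0 ≤ crossZero b ν m < ρ`.
  exact ⟨fun h => ⟨h.1, hm.trans_lt h.1, h.2⟩, fun h => ⟨h.1, h.2.2⟩⟩

/-- Under `τ = b e^{-z}` the measure `τ dτ` becomes `-w dz`, and the sign is absorbed by reversing
the limits. -/
theorem integral_crossU_sq {b ν ρ : ℝ} (hb : 1 < b) (hν : 0 ≤ ν) (hρ : 0 < ρ) :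
    ∫ τ in (1 : ℝ)..b, crossU b ν ρ τ ^ 2 * τ =
      ∫ z in (0 : ℝ)..Real.log b, (b * Real.exp (-z)) ^ 2 * crossU b ν ρ (b * Real.exp (-z)) *
        crossU b ν ρ (b * Real.exp (-z)) := by
  have hb0 : 0 < b := by linarith
  have hYc := (isSturmFamily_crossU hb0 hν).continuous_sol hρ
  have hU : ContinuousOn (crossU b ν ρ) (Set.Ioi 0) := by
    have h1 : ContinuousOn (fun t => Real.log (b / t)) (Set.Ioi 0) := by
      refine ContinuousOn.log (continuousOn_const.div continuousOn_id fun t ht => ?_) fun t ht => ?_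
      · exact (Set.mem_Ioi.1 ht).ne'
      · exact (div_pos hb0 (Set.mem_Ioi.1 ht)).ne'
    refine (hYc.comp_continuousOn h1).congr fun t ht => ?_
    simp only [Function.comp_apply]
    rw [mul_exp_neg_log_div hb0 ht]
  have hsub := intervalIntegral.integral_comp_mul_deriv' (a := 0) (b := Real.log b)
    (f := fun z => b * Real.exp (-z)) (f' := fun z => -(b * Real.exp (-z)))
    (g := fun τ => crossU b ν ρ τ ^ 2 * τ) (fun z _ => hasDerivAt_mul_exp_neg b z)
    (by fun_prop) (by
      refine ((hU.pow 2).mul continuousOn_id).mono ?_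
      rintro _ ⟨z, _, rfl⟩
      exact Set.mem_Ioi.2 (by positivity))
  have h1 : b * Real.exp (-Real.log b) = 1 := by
    simpa using mul_exp_neg_log_div hb0 one_pos
  simp only [neg_zero, Real.exp_zero, mul_one, h1, Function.comp_apply] at hsub
  rw [intervalIntegral.integral_symm, ← hsub, ← intervalIntegral.integral_neg]
  refine intervalIntegral.integral_congr fun z _ => ?_
  ring

theorem tendstoUniformlyOn_sum_crossTerm {b ν s : ℝ} (hs : 1 < s) (hsb : s < b) (hν : 0 ≤ ν)
    {u v u' v' : ℝ → ℝ} (hp : IsDirichletPair (ν ^ 2) (Real.log b) u v u' v') :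
    TendstoUniformlyOn (fun (M : ℕ) (t : ℝ) => ∑ m ∈ Finset.Icc 1 M, crossTerm b ν s t m)
      (fun t => if t ≤ s then u (Real.log (b / s)) * v (Real.log (b / t))
        else u (Real.log (b / t)) * v (Real.log (b / s))) atTop (Set.Icc 1 b) := by
  have hb : 1 < b := hs.trans hsb
  have hb0 : 0 < b := by linarith
  have hs0 : 0 < s := by linarith
  have hmem : ∀ t ∈ Set.Icc 1 b, Real.log (b / t) ∈ Set.Icc 0 (Real.log b) := by
    intro t ht
    have ht0 : 0 < t := by linarith [ht.1]
    refine ⟨Real.log_nonneg ((one_le_div ht0).2 ht.2), Real.log_le_log (by positivity) ?_⟩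
    exact div_le_self hb0.le ht.1
  obtain ⟨hmono, himage⟩ := crossZero_enumerates hb hν
  -- The shift by one discards the auxiliary value `crossZero b ν 0 = 0`.
  have hrange : Set.range (fun m => crossZero b ν (m + 1)) =
      sturmZeros (Real.log b) (fun ρ z => crossU b ν ρ (b * Real.exp (-z))) := by
    rw [sturmZeros_crossU hb0, ← himage]
    ext ρ
    constructor
    · rintro ⟨m, rfl⟩
      exact ⟨m + 1, by simp, rfl⟩
    · rintro ⟨m, hm, rfl⟩
      exact ⟨m - 1, by simp only [Nat.sub_add_cancel (Set.mem_Ici.1 hm)]⟩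
  have hpos : ∀ m, 0 < crossZero b ν (m + 1) := fun m =>
    (hrange ▸ Set.mem_range_self m : crossZero b ν (m + 1) ∈ sturmZeros _ _).1
  have key := tendstoUniformlyOn_green hp (Real.log_pos hb) (isSturmFamily_crossU hb0 hν)
    (hmono.injective.comp (add_left_injective 1)) hrange (hmem s ⟨hs.le, hsb.le⟩)
  have key' := (key.comp fun t => Real.log (b / t)).mono (s' := Set.Icc 1 b) hmem
  refine (key'.congr ?_).congr_right fun t ht => ?_
  · refine Eventually.of_forall fun M t ht => ?_
    have ht0 : 0 < t := by linarith [ht.1]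
    have hsum : ∑ m ∈ Finset.Icc 1 M, crossTerm b ν s t m =
        ∑ m ∈ Finset.range M, crossTerm b ν s t (m + 1) := by
      rw [Finset.range_eq_Ico, Finset.sum_Ico_add' (fun m => crossTerm b ν s t m) 0 M 1]
      rfl
    simp only [Function.comp_apply, hsum]
    refine Finset.sum_congr rfl fun m _ => ?_
    rw [crossTerm, integral_crossU_sq hb hν (hpos m), mul_exp_neg_log_div hb0 hs0,
      mul_exp_neg_log_div hb0 ht0]
  · have ht0 : 0 < t := by linarith [ht.1]
    -- The change of variable reverses order, so `t ≤ s` selects the branch with `log (b / s)` in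
    -- `u`.
    have hiff : Real.log (b / s) ≤ Real.log (b / t) ↔ t ≤ s := by
      rw [Real.log_le_log_iff (by positivity) (by positivity), div_le_div_iff_of_pos_left hb0 hs0 ht0]
    simp only [Function.comp_apply, hiff]

theorem psiFun_eq (ν : ℝ) {t : ℝ} (ht : 0 < t) : psiFun ν t = 2 * Real.sinh (ν * Real.log t) := by
  rw [psiFun, Real.rpow_def_of_pos ht, Real.rpow_def_of_pos ht, Real.sinh_eq]
  ring_nf

theorem mainTheorem8 (b s : ℝ) (hs : 1 < s) (hsb : s < b) :
    (∀ ν : ℝ, 0 ≤ ν →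
      StrictMono (crossZero b ν) ∧
      crossZero b ν '' Set.Ici 1 = {ρ : ℝ | 0 < ρ ∧ crossU b ν ρ 1 = 0}) ∧
    (∀ ν : ℝ, 0 < ν →
      TendstoUniformlyOn
        (fun (M : ℕ) (t : ℝ) => 2 * ν * ∑ m ∈ Finset.Icc 1 M, crossTerm b ν s t m)
        (fun t : ℝ =>
          if t ≤ s then psiFun ν t * psiFun ν (b / s) / psiFun ν b
          else psiFun ν s * psiFun ν (b / t) / psiFun ν b)
        Filter.atTop (Set.Icc 1 b)) ∧
    TendstoUniformlyOn
      (fun (M : ℕ) (t : ℝ) => ∑ m ∈ Finset.Icc 1 M, crossTerm b 0 s t m)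
      (fun t : ℝ =>
        if t ≤ s then Real.log t * Real.log (b / s) / Real.log b
        else Real.log s * Real.log (b / t) / Real.log b)
      Filter.atTop (Set.Icc 1 b) := by
  have hb : 1 < b := hs.trans hsb
  have hb0 : 0 < b := by linarith
  have hs0 : 0 < s := by linarith
  have hL := Real.log_pos hb
  have hlog : ∀ {t : ℝ}, 0 < t → Real.log b - Real.log (b / t) = Real.log t := fun ht => by
    rw [Real.log_div hb0.ne' ht.ne']; ring
  refine ⟨fun ν hν => crossZero_enumerates hb hν, fun ν hν => ?_, ?_⟩
  · have key := tendstoUniformlyOn_sum_crossTerm hs hsb hν.le (isDirichletPair_sinh hν hL)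
    have hmul : UniformContinuous fun x : ℝ => 2 * ν * x := uniformContinuous_id.const_mul' (2 * ν)
    refine (hmul.comp_tendstoUniformlyOn key).congr_right fun t ht => ?_
    have ht0 : 0 < t := by linarith [ht.1]
    have hS : 0 < Real.sinh (ν * Real.log b) := Real.sinh_pos_iff.2 (by positivity)
    simp only [Function.comp_apply, hlog hs0, hlog ht0]
    rw [psiFun_eq ν ht0, psiFun_eq ν hs0, psiFun_eq ν hb0, psiFun_eq ν (div_pos hb0 hs0),
      psiFun_eq ν (div_pos hb0 ht0)]
    -- The Green function carries `1 / (ν sinh)`; the `ν` of the prefactor cancels it, and the 2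
    -- matches the quotient of two factors `2 sinh` by one.
    split_ifs
    · field_simp
    · field_simp
  · refine (tendstoUniformlyOn_sum_crossTerm hs hsb le_rfl
      (isDirichletPair_linear hL)).congr_right fun t ht => ?_
    have ht0 : 0 < t := by linarith [ht.1]
    simp only [hlog hs0, hlog ht0]
    split_ifs
    · ring
    · ring
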